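/- Let $k$ be a field of characteristic different from $2$, let $G$ be a finite group acting linearly on a finite-dimensional $k$-vector space $V$ (write ${}^gv$ for the action), and let $$\lambda: kG\times V\to kG,\qquad \kappa: V\times V\to kG\oplus (V\otimes kG)$$ be bilinear maps with $\kappa$ alternating, i.e. $\kappa(v,v)=0$ for all $v\in V$. Let $\kappa^C$ and $\kappa^L$ be the projections of $\kappa$ onto $kG$ and $V\otimes kG$, and write $\lambda(g,v)=\sum_{h\in G}\lambda_h(g,v)\,h$, $\kappa^C(u,v)=\sum_{a\in G}\kappa^C_a(u,v)\,a$, $\kappa^L(u,v)=\sum_{a\in G}\kappa^L_a(u,v)\otimes a$ with $\lambda_h(g,v),\kappa^C_a(u,v)\in k$ and $\kappa^L_a(u,v)\in V$. Let $\mathcal H_{\lambda,\kappa}$ be the associative unital $k$-algebra generated by the group algebra $kG$ and the vector space $V$ subject to the relations $$gv-{}^gv\,g-\lambda(g,v)\quad(g\in G,\ v\in V),\qquad vw-wv-\kappa(v,w)\quad(v,w\in V),$$ where $v\otimes a\in V\otimes kG$ is read as the product $va$. Filter it by putting $kG$ in degree $0$ and $V$ in degree $1$. Let $S(V)\rtimes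 G$ be the skew group algebra of the symmetric algebra $S(V)$, graded with $kG$ in degree $0$ and $V$ in degree $1$. One says that $\mathcal H_{\lambda,\kappa}$ is a PBW deformation of $S(V)\rtimes G$ if its associated graded algebra $\mathrm{Gr}\,\mathcal H_{\lambda,\kappa}$ is isomorphic to $S(V)\rtimes G$ as a graded $k$-algebra. Theorem. $\mathcal H_{\lambda,\kappa}$ is a PBW deformation of $S(V)\rtimes G$ if and only if the following hold for all $g,h\in G$ and all $u,v,w,v_1,v_2,v_3\in V$ (the identities (1) and (2) being in $kG$, (3) and (4) in $V$, (5) in $k$, and (6) in $S(V)$): (1) $\lambda(gh,v)=\lambda(g,{}^hv)\,h+g\,\lambda(h,v)$; (2) $\kappa^C({}^gu,{}^gv)\,g-g\,\kappa^C(u,v)=\lambda(\lambda(g,v),u)-\lambda(\lambda(g,u),v)+\sum_{a\in G}\lambda\big(g,\kappa^L_a(u,v)\big)\,a$; (3) ${}^g\big(\kappa^L_{g^{-1}h}(u,v)\big)-\kappa^L_{hg^{-1}}({}^gu,{}^gv)=\lambda_h(g,u)\,({}^hv-{}^gv)-\lambda_h(g,v)\,({}^hu-{}^gu)$; (4) $\displaystyle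 0=2\sum_{\sigma\in \mathrm{Alt}_3}\kappa^C_g(v_{\sigma(1)},v_{\sigma(2)})\,(v_{\sigma(3)}-{}^gv_{\sigma(3)})+\sum_{a\in G}\sum_{\sigma\in \mathrm{Alt}_3}\kappa^L_{ga^{-1}}\big(v_{\sigma(1)}+{}^av_{\sigma(1)},\ \kappa^L_a(v_{\sigma(2)},v_{\sigma(3)})\big)-2\sum_{a\in G}\sum_{\sigma\in \mathrm{Alt}_3}\lambda_g(a,v_{\sigma(3)})\,\kappa^L_a(v_{\sigma(1)},v_{\sigma(2)})$; (5) $\displaystyle 2\sum_{\sigma\in \mathrm{Alt}_3}\lambda_g\big(\kappa^C(v_{\sigma(1)},v_{\sigma(2)}),v_{\sigma(3)}\big)=\sum_{a\in G}\sum_{\sigma\in \mathrm{Alt}_3}\kappa^C_{ga^{-1}}\big(v_{\sigma(1)}+{}^av_{\sigma(1)},\ \kappa^L_a(v_{\sigma(2)},v_{\sigma(3)})\big)$, where $\lambda_g(x,v)$ for $x\in kG$ is the coefficient of $g$ in $\lambda(x,v)$; (6) $0=\kappa^L_g(u,v)\,(w-{}^gw)+\kappa^L_g(v,w)\,(u-{}^gu)+\kappa^L_g(w,u)\,(v-{}^gv)$.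 -/

import Mathlib

open scoped TensorProduct DirectSum

/-!
## The associated graded algebra of a filtered algebra
-/

namespace FilteredAlg

variable {k A : Type*} [CommRing k] [Ring A] [Algebra k A]

/-- `⋃ i < n, F i`, as a submodule; it is `F (n - 1)` for an increasing filtration and `n > 0`,
and `0` for `n = 0`. -/
def below (F : ℕ → Submodule k A) (n : ℕ) : Submodule k A := ⨆ i, ⨆ _ : i < n, F i

/-- The `n`-th piece `F n / F (n - 1)` of the associated graded algebra. -/
def GrPiece (F : ℕ → Submodule k A) (n : ℕ) : Type _ :=
  F n ⧸ (below F n).comap (F n).subtype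

variable (F : ℕ → Submodule k A)

instance (n : ℕ) : AddCommGroup (GrPiece F n) :=
  inferInstanceAs (AddCommGroup (F n ⧸ (below F n).comap (F n).subtype))

instance (n : ℕ) : Module k (GrPiece F n) :=
  inferInstanceAs (Module k (F n ⧸ (below F n).comap (F n).subtype))

/-- The class in `F n / F (n - 1)` of an element of `F n`. -/
def grMk (n : ℕ) : F n →ₗ[k] GrPiece F n := ((below F n).comap (F n).subtype).mkQ

theorem grMk_surjective (n : ℕ) : Function.Surjective (grMk F n) :=
  Submodule.mkQ_surjective _

theorem grMk_eq_zero {n : ℕ} (x : F n) : grMk F n x = 0 ↔ (x : A) ∈ below F n := by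
  change Submodule.Quotient.mk x = 0 ↔ _
  rw [Submodule.Quotient.mk_eq_zero]
  rfl

theorem gradedMk_eq {i j : ℕ} (h : i = j) (x : F i) (y : F j) (hxy : (x : A) = y) :
    (GradedMonoid.mk i (grMk F i x) : GradedMonoid (GrPiece F)) =
      GradedMonoid.mk j (grMk F j y) := by
  subst h
  rw [Subtype.ext hxy]

variable [SetLike.GradedMonoid F]

theorem mul_mem_below_right {i j : ℕ} {x y : A} (hx : x ∈ F i) (hy : y ∈ below F j) :
    x * y ∈ below F (i + j) := by
  have h : below F j ≤ (below F (i + j)).comap (LinearMap.mulLeft k x) := by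
    refine iSup₂_le fun l hl z hz => ?_
    exact (le_iSup₂_of_le (f := fun m (_ : m < i + j) => F m) (i + l) (by omega) le_rfl)
      (SetLike.mul_mem_graded hx hz)
  exact h hy

theorem mul_mem_below_left {i j : ℕ} {x y : A} (hx : x ∈ below F i) (hy : y ∈ F j) :
    x * y ∈ below F (i + j) := by
  have h : below F i ≤ (below F (i + j)).comap (LinearMap.mulRight k y) := by
    refine iSup₂_le fun l hl z hz => ?_
    exact (le_iSup₂_of_le (f := fun m (_ : m < i + j) => F m) (l + j) (by omega) le_rfl)
      (SetLike.mul_mem_graded hz hy)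
  exact h hx

/-- The multiplication `F i × F j → F (i + j)` of a filtered algebra. -/
def filMul (i j : ℕ) : F i →ₗ[k] F j →ₗ[k] F (i + j) :=
  LinearMap.mk₂ k (fun x y => ⟨(x : A) * y, SetLike.mul_mem_graded x.2 y.2⟩)
    (fun _ _ _ => Subtype.ext (add_mul _ _ _))
    (fun _ _ _ => Subtype.ext (smul_mul_assoc _ _ _))
    (fun _ _ _ => Subtype.ext (mul_add _ _ _))
    (fun _ _ _ => Subtype.ext (mul_smul_comm _ _ _))

/-- The multiplication of the associated graded algebra on homogeneous pieces:
the product of the classes of `x` and `y` is the class of `x * y`. -/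
def grMul (i j : ℕ) : GrPiece F i →ₗ[k] GrPiece F j →ₗ[k] GrPiece F (i + j) :=
  Submodule.liftQ _
    (LinearMap.flip (Submodule.liftQ _ (LinearMap.flip ((filMul F i j).compr₂ (grMk F (i + j))))
      (by
        intro y hy
        ext x
        exact (grMk_eq_zero F _).2 (mul_mem_below_right F x.2 hy))))
    (by
      intro x hx
      refine LinearMap.ext fun y => ?_
      obtain ⟨y, rfl⟩ := grMk_surjective F j y
      exact (grMk_eq_zero F _).2 (mul_mem_below_left F hx y.2))

theorem grMul_mk {i j : ℕ} (x : F i) (y : F j) :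
    grMul F i j (grMk F i x) (grMk F j y) =
      grMk F (i + j) ⟨(x : A) * y, SetLike.mul_mem_graded x.2 y.2⟩ := rfl

instance : GradedMonoid.GMul (GrPiece F) where
  mul {i j} x y := grMul F i j x y

instance : GradedMonoid.GOne (GrPiece F) where
  one := grMk F 0 ⟨1, SetLike.one_mem_graded F⟩

instance : DirectSum.GRing (GrPiece F) where
  toGMul := inferInstance
  toGOne := inferInstance
  mul_zero {i j} x := map_zero (grMul F i j x)
  zero_mul {i j} y := LinearMap.map_zero₂ (grMul F i j) y
  mul_add {i j} x y z := map_add (grMul F i j x) y z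
  add_mul {i j} x y z := LinearMap.map_add₂ (grMul F i j) x y z
  one_mul := by
    rintro ⟨i, x⟩
    obtain ⟨x, rfl⟩ := grMk_surjective F i x
    exact gradedMk_eq F (zero_add i) _ _ (one_mul (x : A))
  mul_one := by
    rintro ⟨i, x⟩
    obtain ⟨x, rfl⟩ := grMk_surjective F i x
    exact gradedMk_eq F (add_zero i) _ _ (mul_one (x : A))
  mul_assoc := by
    rintro ⟨i, x⟩ ⟨j, y⟩ ⟨l, z⟩
    obtain ⟨x, rfl⟩ := grMk_surjective F i x
    obtain ⟨y, rfl⟩ := grMk_surjective F j y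
    obtain ⟨z, rfl⟩ := grMk_surjective F l z
    exact gradedMk_eq F (add_assoc i j l) _ _ (mul_assoc (x : A) y z)
  natCast n := n • grMk F 0 ⟨1, SetLike.one_mem_graded F⟩
  natCast_zero := zero_smul _ _
  natCast_succ n := succ_nsmul _ n
  intCast n := n • grMk F 0 ⟨1, SetLike.one_mem_graded F⟩
  intCast_ofNat n := natCast_zsmul _ n
  intCast_negSucc_ofNat n := negSucc_zsmul _ n

theorem algebraMap_mem (r : k) : algebraMap k A r ∈ F 0 := by
  rw [Algebra.algebraMap_eq_smul_one]
  exact (F 0).smul_mem r (SetLike.one_mem_graded F)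

instance : DirectSum.GAlgebra k (GrPiece F) where
  toFun := ((grMk F 0).comp
    ((Algebra.linearMap k A).codRestrict (F 0) (algebraMap_mem F))).toAddMonoidHom
  map_one := congrArg (grMk F 0) (Subtype.ext (map_one (algebraMap k A)))
  map_mul r s := gradedMk_eq F (add_zero 0).symm ⟨_, algebraMap_mem F (r * s)⟩
    ⟨algebraMap k A r * algebraMap k A s,
      SetLike.mul_mem_graded (algebraMap_mem F r) (algebraMap_mem F s)⟩
    (map_mul (algebraMap k A) r s)
  commutes := by
    rintro r ⟨i, x⟩
    obtain ⟨x, rfl⟩ := grMk_surjective F i x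
    exact gradedMk_eq F (by omega)
      ⟨algebraMap k A r * x, SetLike.mul_mem_graded (algebraMap_mem F r) x.2⟩
      ⟨x * algebraMap k A r, SetLike.mul_mem_graded x.2 (algebraMap_mem F r)⟩
      (Algebra.commutes r (x : A))
  smul_def := by
    rintro r ⟨i, x⟩
    obtain ⟨x, rfl⟩ := grMk_surjective F i x
    exact gradedMk_eq F (zero_add i).symm (r • x)
      ⟨algebraMap k A r * x, SetLike.mul_mem_graded (algebraMap_mem F r) x.2⟩
      (Algebra.smul_def r (x : A))

/-- The associated graded algebra `⨁ n, F n / F (n - 1)` of a filtered `k`-algebra; its ring and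
`k`-algebra structures are those of Mathlib for direct sums, from the instances above. -/
abbrev Gr : Type _ := ⨁ n, GrPiece F n

/-- The filtration of an algebra determined by a subalgebra `B` (in degree `0`) and a subspace `W`
(in degree `1`): the `n`-th step is spanned by the products `b₀ w₁ b₁ w₂ b₂ ⋯ wᵢ bᵢ`, `i ≤ n`. -/
def wordFiltration (B : Subalgebra k A) (W : Submodule k A) (n : ℕ) : Submodule k A :=
  ⨆ i, ⨆ _ : i ≤ n, Subalgebra.toSubmodule B * (W * Subalgebra.toSubmodule B) ^ i

theorem words_mul (B : Subalgebra k A) (W : Submodule k A) (i : ℕ) :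
    Subalgebra.toSubmodule B * (W * Subalgebra.toSubmodule B) ^ i * Subalgebra.toSubmodule B =
      Subalgebra.toSubmodule B * (W * Subalgebra.toSubmodule B) ^ i := by
  cases i with
  | zero => rw [pow_zero, mul_one, (Subalgebra.isIdempotentElem_toSubmodule B).eq]
  | succ i => rw [pow_succ, mul_assoc, mul_assoc, mul_assoc, (Subalgebra.isIdempotentElem_toSubmodule B).eq]

instance (B : Subalgebra k A) (W : Submodule k A) :
    SetLike.GradedMonoid (wordFiltration B W) where
  one_mem := by
    refine (le_iSup₂_of_le (f := fun m (_ : m ≤ 0) =>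
      Subalgebra.toSubmodule B * (W * Subalgebra.toSubmodule B) ^ m) 0 le_rfl le_rfl) ?_
    rw [pow_zero, mul_one]
    exact B.one_mem
  mul_mem i j x y hx hy := by
    have h : wordFiltration B W i * wordFiltration B W j ≤ wordFiltration B W (i + j) := by
      simp only [wordFiltration, Submodule.iSup_mul, Submodule.mul_iSup]
      refine iSup₂_le fun b hb => iSup₂_le fun a ha => ?_
      refine le_iSup₂_of_le (f := fun m (_ : m ≤ i + j) =>
        Subalgebra.toSubmodule B * (W * Subalgebra.toSubmodule B) ^ m) (a + b) (by omega) ?_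
      rw [← mul_assoc, words_mul, mul_assoc, pow_add]
    exact h (Submodule.mul_mem_mul hx hy)

end FilteredAlg

/-!
## The skew group algebra and its deformations
-/

namespace DrinfeldOrbifold

variable (k G V : Type*) [Field k] [Group G] [AddCommGroup V] [Module k V]

section Action

variable [DistribMulAction G V] [SMulCommClass G k V]

/-- The algebra endomorphism of `S(V)` that extends the action of `g` on `V`. -/
noncomputable def symAct (g : G) : SymmetricAlgebra k V →ₐ[k] SymmetricAlgebra k V :=
  SymmetricAlgebra.lift ((SymmetricAlgebra.ι k V).comp (DistribSMul.toLinearMap k V g))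

@[simp]
theorem symAct_ι (g : G) (v : V) :
    symAct k G V g (SymmetricAlgebra.ι k V v) = SymmetricAlgebra.ι k V (g • v) := by
  simp [symAct]

/-- The action of `G` on `S(V)` by graded algebra automorphisms induced by the action on `V`. -/
noncomputable instance : MulSemiringAction G (SymmetricAlgebra k V) where
  smul g x := symAct k G V g x
  one_smul x := by
    have h : symAct k G V 1 = AlgHom.id k _ := by
      apply SymmetricAlgebra.algHom_ext
      ext v
      simp
    exact DFunLike.congr_fun h x
  mul_smul g h x := by
    have e : symAct k G V (g * h) = (symAct k G V g).comp (symAct k G V h) := by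
      apply SymmetricAlgebra.algHom_ext
      ext v
      simp [mul_smul]
    exact DFunLike.congr_fun e x
  smul_zero g := map_zero (symAct k G V g)
  smul_add g := map_add (symAct k G V g)
  smul_one g := map_one (symAct k G V g)
  smul_mul g := map_mul (symAct k G V g)

instance : SMulCommClass G k (SymmetricAlgebra k V) where
  smul_comm g r x := map_smul (symAct k G V g) r x

/-- The skew group algebra `S(V) ⋊ G`: the free `S(V)`-module on `G` with product
`(s g) (t h) = s (ᵍt) (g h)`. -/
abbrev SkewGroupAlgebra : Type _ := SkewMonoidAlgebra (SymmetricAlgebra k V) G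

/-- The degree `n` part `Sⁿ(V) ⊗ kG` of the skew group algebra, where `Sⁿ(V)` is spanned by the
products of `n` vectors. -/
def skewDeg (n : ℕ) : Submodule k (SkewGroupAlgebra k G V) where
  carrier := {f | ∀ g, f.coeff g ∈ LinearMap.range (SymmetricAlgebra.ι k V) ^ n}
  add_mem' hf hf' g := by
    rw [SkewMonoidAlgebra.coeff_add]
    exact Submodule.add_mem _ (hf g) (hf' g)
  zero_mem' g := by
    rw [SkewMonoidAlgebra.coeff_zero]
    exact Submodule.zero_mem _
  smul_mem' r f hf g := by
    rw [SkewMonoidAlgebra.coeff_smul]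
    exact Submodule.smul_mem _ r (hf g)

end Action

variable {k G V}

/-- The component `V ⊗ kG → V`, `∑ₐ vₐ ⊗ a ↦ vₐ`, at `a ∈ G`. -/
noncomputable def coeffAt (a : G) : V ⊗[k] MonoidAlgebra k G →ₗ[k] V :=
  (TensorProduct.rid k V).toLinearMap ∘ₗ
    LinearMap.lTensor V (Finsupp.lapply a ∘ₗ (MonoidAlgebra.coeffLinearEquiv k).toLinearMap)

/-- The group element `g`, in `kG`. -/
noncomputable abbrev elt (k : Type*) {G : Type*} [Field k] [Group G] (g : G) : MonoidAlgebra k G :=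
  MonoidAlgebra.of k G g

variable (lam : MonoidAlgebra k G →ₗ[k] V →ₗ[k] MonoidAlgebra k G)
  (kap : V →ₗ[k] V →ₗ[k] MonoidAlgebra k G × (V ⊗[k] MonoidAlgebra k G))

/-- `κᶜ`, the projection of `κ` to `kG`. -/
noncomputable def kapC (v w : V) : MonoidAlgebra k G := (kap v w).1

/-- `κᴸ`, the projection of `κ` to `V ⊗ kG`. -/
noncomputable def kapL (v w : V) : V ⊗[k] MonoidAlgebra k G := (kap v w).2

/-- `κᴸₐ : V × V → V`, where `κᴸ(v, w) = ∑ₐ κᴸₐ(v, w) ⊗ a`. -/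
noncomputable def kapLAt (a : G) (v w : V) : V := coeffAt a (kapL kap v w)

/-- `κᶜₐ : V × V → k`, where `κᶜ(v, w) = ∑ₐ κᶜₐ(v, w) a`. -/
noncomputable def kapCAt (a : G) (v w : V) : k := (kapC kap v w).coeff a

/-- `λₕ : G × V → k`, where `λ(g, v) = ∑ₕ λₕ(g, v) h`. -/
noncomputable def lamAt (h g : G) (v : V) : k := (lam (elt k g) v).coeff h

/-- The free algebra on the vector space `kG ⊕ V`. -/
abbrev FreeGV (k G V : Type*) [Field k] [Group G] [AddCommGroup V] [Module k V] : Type _ :=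
  TensorAlgebra k (MonoidAlgebra k G × V)

/-- The generators from `kG`. -/
noncomputable def inG : MonoidAlgebra k G →ₗ[k] FreeGV k G V :=
  TensorAlgebra.ι k ∘ₗ LinearMap.inl k (MonoidAlgebra k G) V

/-- The generators from `V`. -/
noncomputable def inV : V →ₗ[k] FreeGV k G V :=
  TensorAlgebra.ι k ∘ₗ LinearMap.inr k (MonoidAlgebra k G) V

/-- The map `V ⊗ kG → FreeGV k G V`, `v ⊗ a ↦ v a`. -/
noncomputable def inVG : V ⊗[k] MonoidAlgebra k G →ₗ[k] FreeGV k G V :=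
  TensorProduct.lift ((LinearMap.mul k (FreeGV k G V)).compl₁₂ inV inG)

/-- The defining relations: those of the algebra `kG`, then
`g v = ᵍv g + λ(g, v)` and `v w = w v + κ(v, w)`. -/
inductive HRel [DistribMulAction G V] : FreeGV k G V → FreeGV k G V → Prop
  | one : HRel (inG 1) 1
  | mul (x y : MonoidAlgebra k G) : HRel (inG (x * y)) (inG x * inG y)
  | act (g : G) (v : V) :
      HRel (inG (elt k g) * inV v) (inV (g • v) * inG (elt k g) + inG (lam (elt k g) v))
  | comm (v w : V) :
      HRel (inV v * inV w) (inV w * inV v + (inG (kapC kap v w) + inVG (kapL kap v w)))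

variable [DistribMulAction G V]

/-- The algebra `H_{λ,κ}` generated by `kG` and `V` subject to the relations above. -/
def Hlk : Type _ := RingQuot (HRel lam kap)

noncomputable instance : Ring (Hlk lam kap) := inferInstanceAs (Ring (RingQuot (HRel lam kap)))

noncomputable instance : Algebra k (Hlk lam kap) :=
  inferInstanceAs (Algebra k (RingQuot (HRel lam kap)))

/-- The quotient map onto `H_{λ,κ}`. -/
noncomputable def quo : FreeGV k G V →ₐ[k] Hlk lam kap := RingQuot.mkAlgHom k (HRel lam kap)

/-- The algebra homomorphism `kG → H_{λ,κ}`. -/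
noncomputable def fromG : MonoidAlgebra k G →ₐ[k] Hlk lam kap :=
  AlgHom.ofLinearMap ((quo lam kap).toLinearMap ∘ₗ inG)
    ((RingQuot.mkAlgHom_rel k (HRel.one (lam := lam) (kap := kap))).trans (map_one (quo lam kap)))
    (fun x y => (RingQuot.mkAlgHom_rel k (HRel.mul (lam := lam) (kap := kap) x y)).trans
      (map_mul (quo lam kap) _ _))

/-- The linear map `V → H_{λ,κ}`. -/
noncomputable def fromV : V →ₗ[k] Hlk lam kap := (quo lam kap).toLinearMap ∘ₗ inV

/-- The filtration of `H_{λ,κ}` with `kG` in degree `0` and `V` in degree `1`. -/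
noncomputable abbrev filtration : ℕ → Submodule k (Hlk lam kap) :=
  FilteredAlg.wordFiltration (fromG lam kap).range (LinearMap.range (fromV lam kap))

/-- `H_{λ,κ}` is a PBW deformation of `S(V) ⋊ G`: its associated graded algebra is isomorphic to
`S(V) ⋊ G` as a graded `k`-algebra, that is, by an isomorphism of `k`-algebras that maps the
degree `n` part onto the degree `n` part for all `n`. -/
def IsPBWDeformation [SMulCommClass G k V] : Prop :=
  ∃ e : FilteredAlg.Gr (filtration lam kap) ≃ₐ[k] SkewGroupAlgebra k G V,
    ∀ n, (LinearMap.range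
      (DirectSum.lof k ℕ (FilteredAlg.GrPiece (filtration lam kap)) n)).map e.toLinearMap =
        skewDeg k G V n

/-- The sum over the alternating group `Alt₃` of the values of `f` at the permuted arguments,
that is, over the cyclic permutations. -/
def altSum {X M : Type*} [AddCommMonoid M] (f : X → X → X → M) (v₁ v₂ v₃ : X) : M :=
  f v₁ v₂ v₃ + f v₂ v₃ v₁ + f v₃ v₁ v₂

end DrinfeldOrbifold

open DrinfeldOrbifold

set_option linter.unusedSectionVars false

/-! All overlaps of the defining relations are computed once, in an arbitrary algebra `E` that
receives `V` and `kG` and satisfies only g v = ᵍv g + λ(g, v). Let R(u, v) = u v - v u - κ(u, v) be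
the commutator defect. Then g R(u, v) - R(ᵍu, ᵍv) g lies in V·kG + kG, and its coefficients measure
the failure of the two conditions comparing κ with its transform under g (`elt_mul_relOp`). For
three vectors, twice the cyclic sum of [κ(x, y), z], corrected by multiples of R, is a quadratic
term plus a term in V·kG + kG that measures the failure of the two Jacobi-type conditions
(`altSum_commutator_kapOp`). The factor 2 makes the quadratic term symmetric in its two vectors, so
it is the polarization of the condition in S(V) and vanishes even in a noncommutative `E` once that
condition holds (`sum_polar_eq_zero`).

Sufficiency takes `E` to be the operators on T(V) ⊗ kG. The derivation rule for λ is what lets kG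
act there (`groupOp_mul`), and the invariance conditions make the span J of all w R(u, v) m stable
under kG. The quotient by J is thus a module over H, and a combination of words that vanishes in H
lies in J (`mem_of_toH_eq_zero`). It remains to see that J contains no nonzero combination of sorted
words. A linear map that kills J up to degree n and fixes sorted words is built by induction on n
(`exists_normalForm`). Each exchange of adjacent letters costs a κ term of lower degree, and a
diamond lemma (`exists_sort_cocycle`) reduces independence of the order of exchanges to two checks:
disjoint exchanges, and a braid of three letters, which is the Jacobi computation divided by 2.
Hence sorted words are independent in H.

Necessity takes `E` to be H itself, where R = 0. There is always a canonical map from S(V) ⋊ G onto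
the associated graded algebra, surjective in each degree. Composing it with any graded isomorphism
back gives a surjective endomorphism of a finite-dimensional space in each degree, so the canonical
map is injective (`injective_of_isPBW`). The overlap identities then hold in H with zero on one
side, and reading them off degree by degree gives the conditions. The quadratic one comes first;
after polarization it removes the quadratic term exactly, and the lower terms follow. -/

namespace DrinfeldOrbifold

/-! ### Overlaps of the relations in an arbitrary algebra -/

section Calculus

variable {k G V : Type*} [Field k] [Group G] [Fintype G] [AddCommGroup V] [Module k V]

theorem eq_sum_smul_elt (x : MonoidAlgebra k G) :
    x = ∑ a : G, x.coeff a • elt k a := by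
  ext g
  simp [MonoidAlgebra.coeff_sum, MonoidAlgebra.of_apply]

theorem tensor_eq_sum_coeffAt (t : V ⊗[k] MonoidAlgebra k G) :
    t = ∑ a : G, coeffAt a t ⊗ₜ[k] elt k a := by
  induction t with
  | zero => simp
  | add x y hx hy =>
    conv_lhs => rw [hx, hy]
    simp only [map_add, TensorProduct.add_tmul, Finset.sum_add_distrib]
  | tmul v x =>
    conv_lhs => rw [eq_sum_smul_elt x, TensorProduct.tmul_sum]
    refine Finset.sum_congr rfl fun a _ => ?_
    simp [coeffAt, MonoidAlgebra.coeffLinearEquiv, TensorProduct.smul_tmul]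

variable (lam : MonoidAlgebra k G →ₗ[k] V →ₗ[k] MonoidAlgebra k G)
  (kap : V →ₗ[k] V →ₗ[k] MonoidAlgebra k G × (V ⊗[k] MonoidAlgebra k G))

/-- `κᶜ` as a bilinear map. -/
noncomputable def kapCLin : V →ₗ[k] V →ₗ[k] MonoidAlgebra k G :=
  kap.compr₂ (LinearMap.fst k _ _)

/-- `κᴸₐ` as a bilinear map. -/
noncomputable def kapLLin (a : G) : V →ₗ[k] V →ₗ[k] V :=
  kap.compr₂ (coeffAt a ∘ₗ LinearMap.snd k _ _)

theorem kapC_eq (u v : V) : kapC kap u v = kapCLin kap u v := rfl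
theorem kapLAt_eq (a : G) (u v : V) : kapLAt kap a u v = kapLLin kap a u v := rfl

variable {E : Type*} [Ring E] [Algebra k E] (X : V →ₗ[k] E) (ρ : MonoidAlgebra k G →ₐ[k] E)

theorem map_eq_sum (x : MonoidAlgebra k G) : ρ x = ∑ a : G, x.coeff a • ρ (elt k a) := by
  conv_lhs => rw [eq_sum_smul_elt x]
  simp only [map_sum, map_smul]

/-- The value of `κ(u, v)` in an algebra to which `V` and `kG` are mapped. -/
noncomputable def kapOp : V →ₗ[k] V →ₗ[k] E :=
  (kapCLin kap).compr₂ ρ.toLinearMap +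
    ∑ a : G, (kapLLin kap a).compr₂ (LinearMap.mulRight k (ρ (elt k a)) ∘ₗ X)

theorem kapOp_apply (u v : V) : kapOp kap X ρ u v =
    ρ (kapCLin kap u v) + ∑ a : G, X (kapLLin kap a u v) * ρ (elt k a) := by
  simp [kapOp, LinearMap.sum_apply]

/-- The defect `u v - v u - κ(u, v)` of the commutator relation. -/
noncomputable def relOp : V →ₗ[k] V →ₗ[k] E :=
  (LinearMap.mul k E).compl₁₂ X X - ((LinearMap.mul k E).compl₁₂ X X).flip - kapOp kap X ρ

theorem relOp_apply (u v : V) : relOp kap X ρ u v =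
    X u * X v - X v * X u - kapOp kap X ρ u v := by
  simp [relOp]

variable {kap} in
theorem kapOp_self (hkap : ∀ v, kap v v = 0) (v : V) : kapOp kap X ρ v v = 0 := by
  simp [kapOp_apply, kapCLin, kapLLin, hkap]

variable {kap} in
theorem kapOp_swap (hkap : ∀ v, kap v v = 0) (u v : V) :
    kapOp kap X ρ u v = - kapOp kap X ρ v u := by
  have h := kapOp_self X ρ hkap (u + v)
  simp only [map_add, LinearMap.add_apply, kapOp_self X ρ hkap] at h
  rw [eq_neg_iff_add_eq_zero]
  simpa [add_comm] using h

variable [DistribMulAction G V] [SMulCommClass G k V]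

variable {lam X ρ}

theorem map_mul_vec
    (hact : ∀ g v, ρ (elt k g) * X v = X (g • v) * ρ (elt k g) + ρ (lam (elt k g) v))
    (x : MonoidAlgebra k G) (v : V) :
    ρ x * X v = ∑ a : G, x.coeff a • (X (a • v) * ρ (elt k a)) + ρ (lam x v) := by
  conv_lhs => rw [map_eq_sum ρ x]
  conv_rhs => rw [eq_sum_smul_elt x]
  simp only [Finset.sum_mul, smul_mul_assoc, hact, smul_add, Finset.sum_add_distrib, map_sum,
    map_smul, LinearMap.sum_apply, LinearMap.smul_apply]
  congr 1
  conv_rhs => rw [← eq_sum_smul_elt x]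

/-- The group algebra part of the overlap of `g`, `u` and `v`. -/
noncomputable def groupDefect (lam : MonoidAlgebra k G →ₗ[k] V →ₗ[k] MonoidAlgebra k G)
    (kap : V →ₗ[k] V →ₗ[k] MonoidAlgebra k G × (V ⊗[k] MonoidAlgebra k G))
    (g : G) (u v : V) : MonoidAlgebra k G :=
  kapC kap (g • u) (g • v) * elt k g - elt k g * kapC kap u v -
    (lam (lam (elt k g) v) u - lam (lam (elt k g) u) v +
      ∑ a : G, lam (elt k g) (kapLAt kap a u v) * elt k a)

/-- The coefficient in `V` of `h` in the overlap of `g`, `u` and `v`. -/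
noncomputable def vecDefect (lam : MonoidAlgebra k G →ₗ[k] V →ₗ[k] MonoidAlgebra k G)
    (kap : V →ₗ[k] V →ₗ[k] MonoidAlgebra k G × (V ⊗[k] MonoidAlgebra k G))
    (g h : G) (u v : V) : V :=
  lamAt lam h g u • (h • v - g • v) - lamAt lam h g v • (h • u - g • u) -
    (g • kapLAt kap (g⁻¹ * h) u v - kapLAt kap (h * g⁻¹) (g • u) (g • v))

theorem elt_mul_vec_mul_vec
    (hact : ∀ g v, ρ (elt k g) * X v = X (g • v) * ρ (elt k g) + ρ (lam (elt k g) v))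
    (g : G) (u v : V) :
    ρ (elt k g) * (X u * X v) = X (g • u) * X (g • v) * ρ (elt k g) +
      ∑ h : G, X (lamAt lam h g v • (g • u) + lamAt lam h g u • (h • v)) * ρ (elt k h) +
      ρ (lam (lam (elt k g) u) v) := by
  rw [← mul_assoc, hact, add_mul, mul_assoc, hact, map_mul_vec hact, mul_add,
    map_eq_sum ρ (lam (elt k g) v)]
  simp only [map_add, map_smul, add_mul, Finset.sum_add_distrib, Finset.mul_sum, mul_smul_comm,
    smul_mul_assoc, lamAt, mul_assoc]
  abel

theorem elt_mul_kapOp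
    (hact : ∀ g v, ρ (elt k g) * X v = X (g • v) * ρ (elt k g) + ρ (lam (elt k g) v))
    (g : G) (u v : V) :
    ρ (elt k g) * kapOp kap X ρ u v = ρ (elt k g * kapCLin kap u v) +
      ∑ h : G, X (g • kapLLin kap (g⁻¹ * h) u v) * ρ (elt k h) +
      ρ (∑ a : G, lam (elt k g) (kapLLin kap a u v) * elt k a) := by
  rw [kapOp_apply, mul_add, ← map_mul, Finset.mul_sum, map_sum, add_assoc]
  congr 1
  -- The component of κᴸ at a is carried to g a, so the coefficient at h comes from a = g⁻¹h.
  rw [← Equiv.sum_comp (Equiv.mulLeft g) (fun h => X (g • kapLLin kap (g⁻¹ * h) u v) * ρ (elt k h)),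
    ← Finset.sum_add_distrib]
  refine Finset.sum_congr rfl fun a _ => ?_
  rw [← mul_assoc, hact, add_mul, mul_assoc, ← map_mul, ← map_mul, ← map_mul]
  simp

theorem kapOp_mul_elt (g : G) (u v : V) :
    kapOp kap X ρ u v * ρ (elt k g) = ρ (kapCLin kap u v * elt k g) +
      ∑ h : G, X (kapLLin kap (h * g⁻¹) u v) * ρ (elt k h) := by
  rw [kapOp_apply, add_mul, ← map_mul, Finset.sum_mul]
  congr 1
  rw [← Equiv.sum_comp (Equiv.mulRight g) (fun h => X (kapLLin kap (h * g⁻¹) u v) * ρ (elt k h))]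
  refine Finset.sum_congr rfl fun a _ => ?_
  rw [mul_assoc, ← map_mul, ← map_mul]
  simp

/-- The quadratic terms ᵍu ᵍv g and ᵍv ᵍu g cancel between the two products, so what remains has
degree at most one in `V`. In H the left side is zero; for operators on words the right side is made
zero by the conditions. -/
theorem elt_mul_relOp
    (hact : ∀ g v, ρ (elt k g) * X v = X (g • v) * ρ (elt k g) + ρ (lam (elt k g) v))
    (g : G) (u v : V) :
    ρ (elt k g) * relOp kap X ρ u v - relOp kap X ρ (g • u) (g • v) * ρ (elt k g) =
      ∑ h : G, X (vecDefect lam kap g h u v) * ρ (elt k h) + ρ (groupDefect lam kap g u v) := by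
  rw [relOp_apply, relOp_apply, mul_sub, mul_sub, elt_mul_vec_mul_vec hact,
    elt_mul_vec_mul_vec hact, elt_mul_kapOp kap hact, sub_mul, sub_mul, kapOp_mul_elt]
  simp only [vecDefect, groupDefect, kapC_eq, kapLAt_eq, map_sub, map_add, map_smul, sub_mul,
    add_mul, smul_sub, Finset.sum_add_distrib, Finset.sum_sub_distrib]
  abel

/-- The coefficient in `V` of `g` in twice the commutator of `z` and `κ(x, y)`, symmetrized. -/
noncomputable def jacobiVec (lam : MonoidAlgebra k G →ₗ[k] V →ₗ[k] MonoidAlgebra k G)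
    (kap : V →ₗ[k] V →ₗ[k] MonoidAlgebra k G × (V ⊗[k] MonoidAlgebra k G))
    (g : G) (x y z : V) : V :=
  (2 : k) • kapCAt kap g x y • (z - g • z) +
    ∑ a : G, kapLAt kap (g * a⁻¹) (z + a • z) (kapLAt kap a x y) -
    (2 : k) • ∑ a : G, lamAt lam g a z • kapLAt kap a x y

/-- The group algebra part of twice the commutator of `κ(x, y)` and `z`, symmetrized. -/
noncomputable def jacobiGroup (lam : MonoidAlgebra k G →ₗ[k] V →ₗ[k] MonoidAlgebra k G)
    (kap : V →ₗ[k] V →ₗ[k] MonoidAlgebra k G × (V ⊗[k] MonoidAlgebra k G))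
    (x y z : V) : MonoidAlgebra k G :=
  (2 : k) • lam (kapC kap x y) z -
    ∑ a : G, kapC kap (z + a • z) (kapLAt kap a x y) * elt k a

theorem kapOp_mul_vec
    (hact : ∀ g v, ρ (elt k g) * X v = X (g • v) * ρ (elt k g) + ρ (lam (elt k g) v))
    (x y z : V) :
    kapOp kap X ρ x y * X z =
      ∑ g : G, X (kapCAt kap g x y • (g • z)) * ρ (elt k g) + ρ (lam (kapC kap x y) z) +
      ∑ a : G, X (kapLAt kap a x y) * X (a • z) * ρ (elt k a) +
      ∑ g : G, X (∑ a : G, lamAt lam g a z • kapLAt kap a x y) * ρ (elt k g) := by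
  rw [kapOp_apply, add_mul, map_mul_vec hact, Finset.sum_mul]
  simp only [mul_assoc, hact, mul_add, Finset.sum_add_distrib]
  rw [← add_assoc]
  congr 1
  · simp [kapCAt, kapC_eq, kapLAt_eq]
  · simp only [map_sum, Finset.sum_mul]
    rw [Finset.sum_comm]
    refine Finset.sum_congr rfl fun a _ => ?_
    rw [map_eq_sum ρ (lam (elt k a) z), Finset.mul_sum]
    refine Finset.sum_congr rfl fun g _ => ?_
    simp [lamAt, kapLAt_eq]

theorem vec_mul_kapOp (x y z : V) :
    X z * kapOp kap X ρ x y =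
      ∑ g : G, X (kapCAt kap g x y • z) * ρ (elt k g) +
      ∑ a : G, X z * X (kapLAt kap a x y) * ρ (elt k a) := by
  rw [kapOp_apply, mul_add, map_eq_sum ρ, Finset.mul_sum, Finset.mul_sum]
  simp [kapCAt, kapC_eq, kapLAt_eq, mul_assoc]

/-- With p = κᴸₐ(x, y), the quadratic part of the commutator is p·ᵃz - z·p. Twice this is the
commutator of p with z + ᵃz minus the anticommutator of p with z - ᵃz. The `relOp` term trades the
commutator for κ(z + ᵃz, p), so only a symmetric quadratic expression survives. -/
theorem two_smul_commutator_kapOp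
    (hact : ∀ g v, ρ (elt k g) * X v = X (g • v) * ρ (elt k g) + ρ (lam (elt k g) v))
    (x y z : V) :
    (2 : k) • (kapOp kap X ρ x y * X z - X z * kapOp kap X ρ x y) +
      ∑ a : G, relOp kap X ρ (z + a • z) (kapLAt kap a x y) * ρ (elt k a) =
    - ∑ a : G, (X (kapLAt kap a x y) * X (z - a • z) + X (z - a • z) * X (kapLAt kap a x y)) *
        ρ (elt k a) -
      ∑ g : G, X (jacobiVec lam kap g x y z) * ρ (elt k g) + ρ (jacobiGroup lam kap x y z) := by
  have hsum : ∑ a : G, relOp kap X ρ (z + a • z) (kapLAt kap a x y) * ρ (elt k a) =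
      ∑ a : G, (X (z + a • z) * X (kapLAt kap a x y) - X (kapLAt kap a x y) * X (z + a • z)) *
        ρ (elt k a) -
      (ρ (∑ a : G, kapC kap (z + a • z) (kapLAt kap a x y) * elt k a) +
      ∑ g : G, X (∑ a : G, kapLAt kap (g * a⁻¹) (z + a • z) (kapLAt kap a x y)) *
        ρ (elt k g)) := by
    simp only [relOp_apply, sub_mul, kapOp_mul_elt, Finset.sum_sub_distrib,
      Finset.sum_add_distrib, map_sum, Finset.sum_mul]
    congr 2
    exact Finset.sum_comm
  rw [hsum, kapOp_mul_vec kap hact, vec_mul_kapOp]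
  simp only [jacobiVec, jacobiGroup, map_sub, map_add, map_smul, sub_mul, add_mul, mul_add,
    mul_sub, smul_sub, smul_add, Finset.sum_add_distrib, Finset.sum_sub_distrib, two_smul,
    Finset.smul_sum, smul_mul_assoc]
  abel

/-- The symmetrized quadratic part of the Jacobi identity, before summation over `Alt₃`. -/
noncomputable def jacobiPolar (kap : V →ₗ[k] V →ₗ[k] MonoidAlgebra k G × (V ⊗[k] MonoidAlgebra k G))
    (X : V →ₗ[k] E) (a : G) (x y z : V) : E :=
  X (kapLAt kap a x y) * X (z - a • z) + X (z - a • z) * X (kapLAt kap a x y)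

theorem altSum_commutator_kapOp
    (hact : ∀ g v, ρ (elt k g) * X v = X (g • v) * ρ (elt k g) + ρ (lam (elt k g) v))
    (x y z : V) :
    altSum (fun x y z => (2 : k) • (kapOp kap X ρ x y * X z - X z * kapOp kap X ρ x y) +
      ∑ a : G, relOp kap X ρ (z + a • z) (kapLAt kap a x y) * ρ (elt k a)) x y z =
    - ∑ a : G, altSum (jacobiPolar kap X a) x y z * ρ (elt k a) -
      ∑ g : G, X (altSum (jacobiVec lam kap g) x y z) * ρ (elt k g) +
      ρ (altSum (jacobiGroup lam kap) x y z) := by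
  simp only [altSum, jacobiPolar]
  rw [two_smul_commutator_kapOp kap hact x y z, two_smul_commutator_kapOp kap hact y z x,
    two_smul_commutator_kapOp kap hact z x y]
  simp only [map_add, add_mul, Finset.sum_add_distrib]
  abel

theorem altSum_commutator_kapOp_eq_zero
    (hact : ∀ g v, ρ (elt k g) * X v = X (g • v) * ρ (elt k g) + ρ (lam (elt k g) v))
    {x y z : V} (hp : ∀ a, altSum (jacobiPolar kap X a) x y z = 0)
    (hjv : ∀ g, altSum (jacobiVec lam kap g) x y z = 0)
    (hjg : altSum (jacobiGroup lam kap) x y z = 0) :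
    altSum (fun x y z => (2 : k) • (kapOp kap X ρ x y * X z - X z * kapOp kap X ρ x y) +
      ∑ a : G, relOp kap X ρ (z + a • z) (kapLAt kap a x y) * ρ (elt k a)) x y z = 0 := by
  rw [altSum_commutator_kapOp kap hact]
  simp [hp, hjv, hjg]

end Calculus

end DrinfeldOrbifold

namespace DrinfeldOrbifold

/-! ### Sorting words with correction terms -/

section Sorting

variable {ι : Type*} [LinearOrder ι]

/-- The number of inversions of a word. -/
def inversions : List ι → ℕ
  | [] => 0
  | x :: l => l.countP (· < x) + inversions l

/-- Letters in front of the pair see a permutation of the same letters to their right, so only the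
inversion of the pair itself is lost. -/
theorem inversions_swap_lt (a c : List ι) {i j : ι} (h : i < j) :
    inversions (a ++ i :: j :: c) < inversions (a ++ j :: i :: c) := by
  induction a with
  | nil => simp [inversions, h, h.not_gt]; omega
  | cons x a ih =>
    have : (a ++ i :: j :: c).countP (· < x) = (a ++ j :: i :: c).countP (· < x) :=
      List.Perm.countP_eq _ (List.Perm.append_left _ (List.Perm.swap ..))
    simp only [List.cons_append, inversions, this]
    omega

theorem not_pairwise_of_descent (a c : List ι) {i j : ι} (h : i < j) :
    ¬ (a ++ j :: i :: c).Pairwise (· ≤ ·) := by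
  intro hp
  have := (List.pairwise_append.1 hp).2.1
  exact absurd ((List.pairwise_cons.1 this).1 i (by simp)) (not_le.2 h)

variable {M : Type*} [AddCommGroup M] (base : List ι → M)
  (δ : List ι → ι → ι → List ι → M)

open Classical in
/-- The value of a word obtained by sorting it, with the correction `δ a j i c` for the step from
`a j i c` to `a i j c`. -/
noncomputable def sortValue (w : List ι) : M :=
  -- The descent is an arbitrary choice; independence of it is the content of `exists_sort_cocycle`.
  if h : ∃ p : List ι × ι × ι × List ι, w = p.1 ++ p.2.1 :: p.2.2.1 :: p.2.2.2 ∧ p.2.2.1 < p.2.1 then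
    sortValue (h.choose.1 ++ h.choose.2.2.1 :: h.choose.2.1 :: h.choose.2.2.2) +
      δ h.choose.1 h.choose.2.1 h.choose.2.2.1 h.choose.2.2.2
  else base w
termination_by inversions w
decreasing_by
  conv_rhs => rw [h.choose_spec.1]
  exact inversions_swap_lt _ _ h.choose_spec.2

theorem sortValue_sorted {w : List ι} (hw : w.Pairwise (· ≤ ·)) :
    sortValue base δ w = base w := by
  rw [sortValue, dif_neg]
  rintro ⟨p, rfl, hp⟩
  exact not_pairwise_of_descent _ _ hp hw

theorem sortValue_exists {w : List ι} (hw : ∃ a j i c, w = a ++ j :: i :: c ∧ i < j) :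
    ∃ a j i c, w = a ++ j :: i :: c ∧ i < j ∧
      sortValue base δ w = sortValue base δ (a ++ i :: j :: c) + δ a j i c := by
  have h : ∃ p : List ι × ι × ι × List ι,
      w = p.1 ++ p.2.1 :: p.2.2.1 :: p.2.2.2 ∧ p.2.2.1 < p.2.1 := by
    obtain ⟨a, j, i, c, h⟩ := hw
    exact ⟨(a, j, i, c), h⟩
  refine ⟨h.choose.1, h.choose.2.1, h.choose.2.2.1, h.choose.2.2.2, h.choose_spec.1,
    h.choose_spec.2, ?_⟩
  conv_lhs => rw [sortValue, dif_pos h]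

/-- **Diamond lemma for sorting.** If the corrections agree on disjoint and on overlapping pairs of
exchanges, then the value of a word does not depend on the way in which it is sorted. -/
theorem exists_sort_cocycle (hself : ∀ a i c, δ a i i c = 0)
    (hswap : ∀ a i j c, δ a j i c = - δ a i j c)
    (hdisj : ∀ a j i c l m d, δ a j i (c ++ l :: m :: d) - δ a j i (c ++ m :: l :: d) =
      δ (a ++ j :: i :: c) l m d - δ (a ++ i :: j :: c) l m d)
    (hbraid : ∀ a l j i c, δ a l j (i :: c) + δ (a ++ [j]) l i c + δ a j i (l :: c) =
      δ (a ++ [l]) j i c + δ a l i (j :: c) + δ (a ++ [i]) l j c) :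
    ∃ N : List ι → M, (∀ w, w.Pairwise (· ≤ ·) → N w = base w) ∧
      ∀ a j i c, N (a ++ j :: i :: c) = N (a ++ i :: j :: c) + δ a j i c := by
  refine ⟨sortValue base δ, fun w => sortValue_sorted base δ, ?_⟩
  set N := sortValue base δ with hN
  -- Induction on the number of inversions: every word reached by removing a descent already obeys
  -- the exchange rule.
  have key : ∀ n, ∀ a j i c, inversions (a ++ j :: i :: c) = n → i < j →
      N (a ++ j :: i :: c) = N (a ++ i :: j :: c) + δ a j i c := by
    intro n
    induction n using Nat.strong_induction_on with
    | _ n ih =>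
    have step : ∀ w a j i c, inversions w < n → w = a ++ j :: i :: c → i < j →
        N w = N (a ++ i :: j :: c) + δ a j i c := by
      rintro _ a j i c hlt rfl hij
      exact ih _ hlt a j i c rfl hij
    -- two descents of the same word, the first one not to the right of the second one
    have conf : ∀ a j i c a' j' i' c', inversions (a ++ j :: i :: c) = n → i < j → i' < j' →
        a ++ j :: i :: c = a' ++ j' :: i' :: c' → a.length ≤ a'.length →
        N (a ++ i :: j :: c) + δ a j i c = N (a' ++ i' :: j' :: c') + δ a' j' i' c' := by
      intro a j i c a' j' i' c' hn hij hij' heq hlen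
      obtain ⟨e, rfl⟩ : ∃ e, a' = a ++ e := by
        rcases List.append_eq_append_iff.1 heq with ⟨e, he, _⟩ | ⟨e, he, _⟩
        · exact ⟨e, he⟩
        · have : e = [] := by
            have := congrArg List.length he
            simp only [List.length_append] at this
            exact List.eq_nil_of_length_eq_zero (by omega)
          exact ⟨[], by simp [he, this]⟩
      rw [List.append_assoc, List.append_cancel_left_eq] at heq
      -- The offset `e` between two descents decides the case: empty means the same pair, one letter
      -- means overlapping pairs, and two or more letters mean disjoint pairs.
      match e, heq with
      | [], heq =>
        simp only [List.nil_append, List.cons.injEq] at heq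
        obtain ⟨rfl, rfl, rfl⟩ := heq
        simp
      | [x], heq =>
        simp only [List.cons_append, List.nil_append, List.cons.injEq] at heq
        obtain ⟨rfl, rfl, rfl⟩ := heq
        -- the word is `a j i i' c'` with `i' < i < j`
        have lt1 := inversions_swap_lt a (i' :: c') hij
        have lt2 := inversions_swap_lt (a ++ [j]) c' hij'
        simp only [List.append_assoc, List.cons_append, List.nil_append] at lt2
        have lt3 := inversions_swap_lt (a ++ [i]) c' (hij'.trans hij)
        simp only [List.append_assoc, List.cons_append, List.nil_append] at lt3
        have lt4 := inversions_swap_lt a (i :: c') (hij'.trans hij)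
        -- Both ways of resolving the overlap are followed down to the common sorted triple i' i j;
        -- the six corrections met on the way are those of `hbraid`.
        have e1 := step (a ++ i :: j :: i' :: c') (a ++ [i]) j i' c' (by omega) (by simp)
          (hij'.trans hij)
        have e2 := step (a ++ i :: i' :: j :: c') a i i' (j :: c') (by omega) rfl hij'
        have e3 := step (a ++ j :: i' :: i :: c') a j i' (i :: c') (by omega) rfl (hij'.trans hij)
        have e4 := step (a ++ i' :: j :: i :: c') (a ++ [i']) j i c' (by omega) (by simp) hij
        simp only [List.append_assoc, List.cons_append, List.nil_append] at e1 e2 e3 e4 ⊢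
        rw [e1, e2, e3, e4]
        have := hbraid a j i i' c'
        rw [← sub_eq_zero] at this ⊢
        rw [← this]
        abel
      | x :: y :: e, heq =>
        simp only [List.cons_append, List.cons.injEq] at heq
        obtain ⟨rfl, rfl, rfl⟩ := heq
        have lt1 := inversions_swap_lt a (e ++ j' :: i' :: c') hij
        have lt2 := inversions_swap_lt (a ++ j :: i :: e) c' hij'
        simp only [List.append_assoc, List.cons_append] at lt2
        have e1 := step (a ++ i :: j :: (e ++ j' :: i' :: c')) (a ++ i :: j :: e) j' i' c'
          (by omega) (by simp) hij'
        have e2 := step (a ++ j :: i :: (e ++ i' :: j' :: c')) a j i (e ++ i' :: j' :: c')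
          (by omega) (by simp) hij
        simp only [List.append_assoc, List.cons_append] at e1 e2 ⊢
        rw [e1, e2]
        have := hdisj a j i e j' i' c'
        rw [sub_eq_sub_iff_add_eq_add] at this
        rw [add_assoc, add_assoc, add_comm (δ _ _ _ _), this, add_comm (δ _ _ _ _)]
    intro a j i c hn hij
    obtain ⟨a', j', i', c', heq, hij', hval⟩ := sortValue_exists base δ ⟨a, j, i, c, rfl, hij⟩
    rw [hN, hval]
    rcases le_total a.length a'.length with hl | hl
    · exact (conf a j i c a' j' i' c' hn hij hij' heq hl).symm
    · exact conf a' j' i' c' a j i c (heq ▸ hn) hij' hij heq.symm hl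
  intro a j i c
  -- Descents are settled by `key`; `hself` and `hswap` extend the rule to equal and to ascending
  -- pairs.
  rcases lt_trichotomy i j with h | rfl | h
  · exact key _ a j i c rfl h
  · rw [hself, add_zero]
  · rw [key _ a i j c rfl h, hswap a i j c, add_assoc, add_neg_cancel, add_zero]

end Sorting

end DrinfeldOrbifold

namespace DrinfeldOrbifold

/-! ### The operators of V and kG on T(V) ⊗ kG -/

section WordModule

variable {k G V ι : Type*} [Field k] [Group G] [Fintype G] [AddCommGroup V] [Module k V]

theorem elt_one : elt k (1 : G) = 1 := map_one _

theorem elt_mul (g h : G) : elt k (g * h) = elt k g * elt k h := map_mul _ _ _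

/-- The vector space `T(V) ⊗ kG`, with the words in a basis of `V`, times the elements of `G`,
as a basis. -/
abbrev WordModule (k G ι : Type*) [Field k] : Type _ := List ι × G →₀ k

/-- The algebra of operators on `T(V) ⊗ kG`. -/
abbrev WordEnd (k G ι : Type*) [Field k] : Type _ := Module.End k (WordModule k G ι)

/-- The basis element `w g`. -/
noncomputable abbrev word (k : Type*) {G ι : Type*} [Field k] (w : List ι) (g : G) :
    WordModule k G ι :=
  Finsupp.single (w, g) 1

theorem wordModule_ext {M : Type*} [AddCommGroup M] [Module k M]
    {f f' : WordModule k G ι →ₗ[k] M} (h : ∀ w g, f (word k w g) = f' (word k w g)) : f = f' :=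
  Finsupp.lhom_ext' fun p => LinearMap.ext_ring (h p.1 p.2)

/-- Left multiplication by vectors. -/
noncomputable def vecOp (b : Module.Basis ι k V) : V →ₗ[k] WordEnd k G ι :=
  b.constr k fun i => Finsupp.linearCombination k fun p => word k (i :: p.1) p.2

@[simp]
theorem vecOp_basis (b : Module.Basis ι k V) (i : ι) (w : List ι) (g : G) :
    vecOp b (b i) (word k w g) = word k (i :: w) g := by
  simp [vecOp, Module.Basis.constr_basis]

variable [DistribMulAction G V] [SMulCommClass G k V]
variable (lam : MonoidAlgebra k G →ₗ[k] V →ₗ[k] MonoidAlgebra k G) (b : Module.Basis ι k V)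

/-- The product `g w h`, expanded by moving `g` to the right. -/
noncomputable def eltMulWord : List ι → G → G → WordModule k G ι
  | [], g, h => word k [] (g * h)
  | i :: w, g, h => vecOp b (g • b i) (eltMulWord w g h) +
      ∑ a : G, lamAt lam a g (b i) • eltMulWord w a h

/-- Left multiplication by elements of `kG`. -/
noncomputable def groupOp : MonoidAlgebra k G →ₗ[k] WordEnd k G ι :=
  (MonoidAlgebra.basis G k).constr k fun g =>
    Finsupp.linearCombination k fun p => eltMulWord lam b p.1 g p.2

theorem groupOp_elt (g : G) (w : List ι) (h : G) :
    groupOp lam b (elt k g) (word k w h) = eltMulWord lam b w g h := by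
  have : elt k g = MonoidAlgebra.basis G k g := by
    simp [elt, MonoidAlgebra.basis_apply, MonoidAlgebra.of_apply]
  rw [groupOp, this, Module.Basis.constr_basis]
  simp

theorem groupOp_eq_sum (x : MonoidAlgebra k G) :
    groupOp lam b x = ∑ a : G, x.coeff a • groupOp lam b (elt k a) := by
  conv_lhs => rw [eq_sum_smul_elt x]
  simp only [map_sum, map_smul]

/-- For a basis vector acting on a word this is the recursion defining `eltMulWord`, and both sides
are linear in `v`. No condition on λ enters. -/
theorem groupOp_mul_vecOp (g : G) (v : V) :
    groupOp lam b (elt k g) * vecOp b v =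
      vecOp b (g • v) * groupOp lam b (elt k g) + groupOp lam b (lam (elt k g) v) := by
  have h : (LinearMap.mulLeft k (groupOp lam b (elt k g))) ∘ₗ vecOp b =
      (LinearMap.mulRight k (groupOp lam b (elt k g))) ∘ₗ vecOp b ∘ₗ
        DistribSMul.toLinearMap k V g + groupOp lam b ∘ₗ lam (elt k g) := by
    refine b.ext fun i => wordModule_ext fun w h => ?_
    simp only [LinearMap.comp_apply, LinearMap.add_apply, LinearMap.mulLeft_apply,
      LinearMap.mulRight_apply, Module.End.mul_apply, vecOp_basis, groupOp_elt, eltMulWord]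
    rw [groupOp_eq_sum lam b (lam (elt k g) (b i))]
    simp only [LinearMap.sum_apply, LinearMap.smul_apply, groupOp_elt, lamAt,
      DistribSMul.toLinearMap_apply]
  simpa using LinearMap.congr_fun h v

variable {lam}

theorem lam_one (h1 : ∀ (g h : G) (v : V),
      lam (elt k (g * h)) v = lam (elt k g) (h • v) * elt k h + elt k g * lam (elt k h) v)
    (v : V) : lam 1 v = 0 := by
  simpa only [mul_one, one_smul, elt_one, one_mul, left_eq_add] using h1 1 1 v

theorem groupOp_one (h1 : ∀ (g h : G) (v : V),
      lam (elt k (g * h)) v = lam (elt k g) (h • v) * elt k h + elt k g * lam (elt k h) v) :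
    groupOp lam b 1 = 1 := by
  refine wordModule_ext fun w h => ?_
  induction w with
  | nil => rw [← elt_one, groupOp_elt]; simp [eltMulWord]
  | cons i w ih =>
    rw [← vecOp_basis b, ← Module.End.mul_apply, ← elt_one, groupOp_mul_vecOp, elt_one, lam_one h1]
    simp [Module.End.mul_apply, ih]

/-- Induction on the word: moving g h past the first letter in one step or in two differs by exactly
the two sides of `h1`, applied to a shorter word. -/
theorem groupOp_mul (h1 : ∀ (g h : G) (v : V),
      lam (elt k (g * h)) v = lam (elt k g) (h • v) * elt k h + elt k g * lam (elt k h) v)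
    (x y : MonoidAlgebra k G) : groupOp lam b (x * y) = groupOp lam b x * groupOp lam b y := by
  refine wordModule_ext fun w l => ?_
  -- by linearity it is enough to consider group elements
  have red : ∀ m : WordModule k G ι,
      (∀ g h : G, groupOp lam b (elt k g * elt k h) m =
        groupOp lam b (elt k g) (groupOp lam b (elt k h) m)) →
      ∀ x y, groupOp lam b (x * y) m = groupOp lam b x (groupOp lam b y m) := by
    intro m hm x y
    rw [eq_sum_smul_elt x, eq_sum_smul_elt y]
    simp only [Finset.sum_mul, Finset.mul_sum, map_sum, map_smul, LinearMap.sum_apply,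
      LinearMap.smul_apply, smul_mul_assoc, mul_smul_comm, hm]
  revert x y
  induction w with
  | nil =>
    refine red _ fun g h => ?_
    rw [← elt_mul, groupOp_elt, groupOp_elt, eltMulWord, eltMulWord, groupOp_elt, eltMulWord,
      mul_assoc]
  | cons i w ih =>
    refine red _ fun g h => ?_
    have e := fun g => congrArg (fun f => f (word k w l)) (groupOp_mul_vecOp lam b g (b i))
    simp only [Module.End.mul_apply, LinearMap.add_apply, vecOp_basis] at e ih
    have e' := fun m => congrArg (fun f => f m) (groupOp_mul_vecOp lam b g (h • b i))
    simp only [Module.End.mul_apply, LinearMap.add_apply] at e'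
    rw [← elt_mul, e, e, map_add, e', h1, map_add, LinearMap.add_apply, ← ih, ← ih, ← ih, elt_mul,
      mul_smul, add_assoc]

/-- The action of `kG` on `T(V) ⊗ kG`. -/
noncomputable def groupAlgOp (h1 : ∀ (g h : G) (v : V),
      lam (elt k (g * h)) v = lam (elt k g) (h • v) * elt k h + elt k g * lam (elt k h) v) :
    MonoidAlgebra k G →ₐ[k] WordEnd k G ι :=
  AlgHom.ofLinearMap (groupOp lam b) (groupOp_one b h1) (groupOp_mul b h1)

end WordModule

end DrinfeldOrbifold

namespace DrinfeldOrbifold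

/-! ### The filtered space of relations in T(V) ⊗ kG -/

section Diamond

variable {k G V ι : Type*} [Field k] [Group G] [Fintype G] [AddCommGroup V] [Module k V]

/-- The span of the words of length at most `n`. -/
noncomputable def wordFil (k G ι : Type*) [Field k] (n : ℕ) : Submodule k (WordModule k G ι) :=
  Submodule.span k {m | ∃ w g, w.length ≤ n ∧ m = word k w g}

theorem word_mem_wordFil {n : ℕ} {w : List ι} (hw : w.length ≤ n) (g : G) :
    word k w g ∈ wordFil k G ι n :=
  Submodule.subset_span ⟨w, g, hw, rfl⟩

theorem wordFil_mono {m n : ℕ} (h : m ≤ n) : wordFil k G ι m ≤ wordFil k G ι n :=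
  Submodule.span_mono fun _ ⟨w, g, hw, e⟩ => ⟨w, g, hw.trans h, e⟩

theorem wordFil_induction {n : ℕ} {S : Submodule k (WordModule k G ι)}
    (h : ∀ w g, w.length ≤ n → word k w g ∈ S) : wordFil k G ι n ≤ S :=
  Submodule.span_le.2 fun _ ⟨w, g, hw, e⟩ => e ▸ h w g hw

theorem exists_mem_wordFil (m : WordModule k G ι) : ∃ n, m ∈ wordFil k G ι n := by
  induction m using Finsupp.induction_linear with
  | zero => exact ⟨0, Submodule.zero_mem _⟩
  | add x y hx hy =>
    obtain ⟨n, hn⟩ := hx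
    obtain ⟨l, hl⟩ := hy
    exact ⟨max n l, Submodule.add_mem _ (wordFil_mono (le_max_left _ _) hn)
      (wordFil_mono (le_max_right _ _) hl)⟩
  | single p c =>
    refine ⟨p.1.length, ?_⟩
    rw [← mul_one c, ← Finsupp.smul_single']
    exact Submodule.smul_mem _ _ (word_mem_wordFil le_rfl p.2)

/-- A submodule that contains the image of a vector under each element of a basis of the source of
a linear map of operators contains its image under all of them. -/
theorem apply_mem_of_basis {W A κ : Type*} [AddCommGroup W] [Module k W] [AddCommGroup A]
    [Module k A] (c : Module.Basis κ k W) (T : W →ₗ[k] Module.End k A) {S : Submodule k A} {m : A}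
    (h : ∀ i, T (c i) m ∈ S) (w : W) : T w m ∈ S := by
  have : (⊤ : Submodule k W) ≤ S.comap ((LinearMap.applyₗ m).comp T) := by
    rw [← c.span_eq, Submodule.span_le]
    rintro _ ⟨i, rfl⟩
    exact h i
  exact this Submodule.mem_top

theorem apply_mem_of_elt {A : Type*} [AddCommGroup A] [Module k A]
    (T : MonoidAlgebra k G →ₗ[k] Module.End k A) {S : Submodule k A} {m : A}
    (h : ∀ g, T (elt k g) m ∈ S) (x : MonoidAlgebra k G) : T x m ∈ S := by
  rw [eq_sum_smul_elt x]
  simp only [map_sum, map_smul, LinearMap.sum_apply, LinearMap.smul_apply]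
  exact Submodule.sum_mem _ fun a _ => Submodule.smul_mem _ _ (h a)

variable (kap : V →ₗ[k] V →ₗ[k] MonoidAlgebra k G × (V ⊗[k] MonoidAlgebra k G))
  (b : Module.Basis ι k V) (ρ : MonoidAlgebra k G →ₐ[k] WordEnd k G ι)

theorem vecOp_mem_wordFil (v : V) {n : ℕ} {m : WordModule k G ι} (hm : m ∈ wordFil k G ι n) :
    vecOp b v m ∈ wordFil k G ι (n + 1) := by
  refine apply_mem_of_basis b (vecOp b) (fun i => ?_) v
  have : wordFil k G ι n ≤ (wordFil k G ι (n + 1)).comap (vecOp b (b i)) :=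
    wordFil_induction fun w g hw => by
      rw [Submodule.mem_comap, vecOp_basis]
      exact word_mem_wordFil (by simpa using hw) g
  exact this hm

/-- The product of the basis vectors of a word. -/
noncomputable def wordOp {E : Type*} [Monoid E] (x : ι → E) (a : List ι) : E := (a.map x).prod

@[simp]
theorem wordOp_nil {E : Type*} [Monoid E] (x : ι → E) : wordOp x [] = 1 := rfl

@[simp]
theorem wordOp_cons {E : Type*} [Monoid E] (x : ι → E) (i : ι) (a : List ι) :
    wordOp x (i :: a) = x i * wordOp x a := by
  simp [wordOp]

theorem wordOp_append {E : Type*} [Monoid E] (x : ι → E) (a c : List ι) :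
    wordOp x (a ++ c) = wordOp x a * wordOp x c := by
  simp [wordOp]

theorem wordOp_word (a c : List ι) (g : G) :
    wordOp (fun i => vecOp b (b i)) a (word k c g) = word k (a ++ c) g := by
  induction a with
  | nil => simp
  | cons i a ih => simp [Module.End.mul_apply, ih]

theorem wordOp_mem_wordFil (a : List ι) {n : ℕ} {m : WordModule k G ι}
    (hm : m ∈ wordFil k G ι n) :
    wordOp (fun i => vecOp b (b i)) a m ∈ wordFil k G ι (a.length + n) := by
  induction a with
  | nil => simpa using hm
  | cons i a ih =>
    rw [wordOp_cons, Module.End.mul_apply, List.length_cons, Nat.add_right_comm]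
    exact vecOp_mem_wordFil b _ ih

/-- The relations of degree at most `n`: the elements `w (u v - v u - κ(u, v)) m`. -/
inductive IsRel : ℕ → WordModule k G ι → Prop
  | rel (u v : V) {n : ℕ} {m : WordModule k G ι} (hm : m ∈ wordFil k G ι n) :
      IsRel (n + 2) (relOp (E := WordEnd k G ι) kap (vecOp b) ρ u v m)
  | vec (v : V) {n : ℕ} {m : WordModule k G ι} (hm : IsRel n m) : IsRel (n + 1) (vecOp b v m)
  | zero (n : ℕ) : IsRel n 0
  | add {n : ℕ} {x y : WordModule k G ι} (hx : IsRel n x) (hy : IsRel n y) : IsRel n (x + y)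
  | smul {n : ℕ} (c : k) {x : WordModule k G ι} (hx : IsRel n x) : IsRel n (c • x)
  | succ {n : ℕ} {x : WordModule k G ι} (hx : IsRel n x) : IsRel (n + 1) x

/-- The relations of degree at most `n`, as a subspace. -/
def relSub (n : ℕ) : Submodule k (WordModule k G ι) where
  carrier := {m | IsRel kap b ρ n m}
  add_mem' := IsRel.add
  zero_mem' := IsRel.zero n
  smul_mem' c _ := IsRel.smul c

theorem relSub_mono : Monotone (relSub kap b ρ) :=
  monotone_nat_of_le_succ fun _ _ => IsRel.succ

variable {kap b ρ} in
theorem relOp_mem_relSub (u v : V) {n : ℕ} {m : WordModule k G ι} (hm : m ∈ wordFil k G ι n) :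
    relOp (E := WordEnd k G ι) kap (vecOp b) ρ u v m ∈ relSub kap b ρ (n + 2) := IsRel.rel u v hm

theorem vecOp_mem_relSub (v : V) {n : ℕ} {m : WordModule k G ι} (hm : m ∈ relSub kap b ρ n) :
    vecOp b v m ∈ relSub kap b ρ (n + 1) := IsRel.vec v hm

theorem wordOp_mem_relSub (a : List ι) {n : ℕ} {m : WordModule k G ι}
    (hm : m ∈ relSub kap b ρ n) :
    wordOp (fun i => vecOp b (b i)) a m ∈ relSub kap b ρ (a.length + n) := by
  induction a with
  | nil => simpa using hm
  | cons i a ih =>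
    rw [wordOp_cons, Module.End.mul_apply, List.length_cons, Nat.add_right_comm]
    exact vecOp_mem_relSub kap b ρ _ ih

variable {kap ρ} {lam : MonoidAlgebra k G →ₗ[k] V →ₗ[k] MonoidAlgebra k G}
variable [DistribMulAction G V] [SMulCommClass G k V]

theorem groupOp_mem_wordFil
    (hnil : ∀ g h, ρ (elt k g) (word k [] h) = word k [] (g * h))
    (hact : ∀ g v, ρ (elt k g) * vecOp b v =
      vecOp b (g • v) * ρ (elt k g) + ρ (lam (elt k g) v))
    (x : MonoidAlgebra k G) {n : ℕ} {m : WordModule k G ι} (hm : m ∈ wordFil k G ι n) :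
    ρ x m ∈ wordFil k G ι n := by
  have key : ∀ (w : List ι) (h : G) (x : MonoidAlgebra k G),
      ρ x (word k w h) ∈ wordFil k G ι w.length := by
    intro w h
    induction w with
    | nil =>
      refine apply_mem_of_elt ρ.toLinearMap fun g => ?_
      rw [AlgHom.toLinearMap_apply, hnil]
      exact word_mem_wordFil le_rfl _
    | cons i w ih =>
      refine apply_mem_of_elt ρ.toLinearMap fun g => ?_
      rw [AlgHom.toLinearMap_apply, ← vecOp_basis b, ← Module.End.mul_apply, hact,
        LinearMap.add_apply, Module.End.mul_apply]
      exact Submodule.add_mem _ (vecOp_mem_wordFil b _ (ih _)) (wordFil_mono (by simp) (ih _))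
  have : wordFil k G ι n ≤ (wordFil k G ι n).comap (ρ x) :=
    wordFil_induction fun w g hw => wordFil_mono hw (key w g x)
  exact this hm

/-- A group element passes through the generating relations by `hgrp` and through vectors by `hact`.
The λ terms of the latter lose a vector, so the degree bound is kept. -/
theorem groupOp_mem_relSub
    (hnil : ∀ g h, ρ (elt k g) (word k [] h) = word k [] (g * h))
    (hact : ∀ g v, ρ (elt k g) * vecOp b v =
      vecOp b (g • v) * ρ (elt k g) + ρ (lam (elt k g) v))
    (hgrp : ∀ g u v, ρ (elt k g) * relOp (E := WordEnd k G ι) kap (vecOp b) ρ u v =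
      relOp (E := WordEnd k G ι) kap (vecOp b) ρ (g • u) (g • v) * ρ (elt k g))
    (x : MonoidAlgebra k G) {n : ℕ} {m : WordModule k G ι} (hm : m ∈ relSub kap b ρ n) :
    ρ x m ∈ relSub kap b ρ n := by
  change IsRel kap b ρ n m at hm
  induction hm generalizing x with
  | rel u v hm =>
    refine apply_mem_of_elt ρ.toLinearMap (fun g => ?_) x
    rw [AlgHom.toLinearMap_apply, ← Module.End.mul_apply, hgrp, Module.End.mul_apply]
    exact IsRel.rel _ _ (groupOp_mem_wordFil b hnil hact _ hm)
  | vec v hm ih =>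
    refine apply_mem_of_elt ρ.toLinearMap (fun g => ?_) x
    rw [AlgHom.toLinearMap_apply, ← Module.End.mul_apply, hact, LinearMap.add_apply,
      Module.End.mul_apply]
    exact Submodule.add_mem _ (IsRel.vec _ (ih _)) (IsRel.succ (ih _))
  | zero => rw [map_zero]; exact Submodule.zero_mem _
  | add hx hy ihx ihy => rw [map_add]; exact Submodule.add_mem _ (ihx x) (ihy x)
  | smul c hx ih => rw [map_smul]; exact Submodule.smul_mem _ _ (ih x)
  | succ hx ih => exact IsRel.succ (ih x)

/-- Used for both filtrations: κ inserts at most one vector, so it raises the degree by at most one.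
-/
theorem kapOp_mem_of {S T : Submodule k (WordModule k G ι)} {m : WordModule k G ι} (hST : S ≤ T)
    (hρ : ∀ x, ρ x m ∈ S) (hX : ∀ v, ∀ y ∈ S, vecOp b v y ∈ T) (u v : V) :
    kapOp (E := WordEnd k G ι) kap (vecOp b) ρ u v m ∈ T := by
  rw [kapOp_apply, LinearMap.add_apply, LinearMap.sum_apply]
  exact Submodule.add_mem _ (hST (hρ _)) (Submodule.sum_mem _ fun a _ => hX _ _ (hρ _))

theorem kapOp_mem_wordFil
    (hnil : ∀ g h, ρ (elt k g) (word k [] h) = word k [] (g * h))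
    (hact : ∀ g v, ρ (elt k g) * vecOp b v =
      vecOp b (g • v) * ρ (elt k g) + ρ (lam (elt k g) v))
    (u v : V) {n : ℕ} {m : WordModule k G ι} (hm : m ∈ wordFil k G ι n) :
    kapOp (E := WordEnd k G ι) kap (vecOp b) ρ u v m ∈ wordFil k G ι (n + 1) :=
  kapOp_mem_of b (wordFil_mono n.le_succ) (fun x => groupOp_mem_wordFil b hnil hact x hm)
    (fun v _ => vecOp_mem_wordFil b v) u v

theorem kapOp_mem_relSub
    (hnil : ∀ g h, ρ (elt k g) (word k [] h) = word k [] (g * h))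
    (hact : ∀ g v, ρ (elt k g) * vecOp b v =
      vecOp b (g • v) * ρ (elt k g) + ρ (lam (elt k g) v))
    (hgrp : ∀ g u v, ρ (elt k g) * relOp (E := WordEnd k G ι) kap (vecOp b) ρ u v =
      relOp (E := WordEnd k G ι) kap (vecOp b) ρ (g • u) (g • v) * ρ (elt k g))
    (u v : V) {n : ℕ} {m : WordModule k G ι} (hm : m ∈ relSub kap b ρ n) :
    kapOp (E := WordEnd k G ι) kap (vecOp b) ρ u v m ∈ relSub kap b ρ (n + 1) :=
  kapOp_mem_of b (relSub_mono kap b ρ n.le_succ)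
    (fun x => groupOp_mem_relSub b hnil hact hgrp x hm)
    (fun v _ => vecOp_mem_relSub kap b ρ v) u v

/-- Ensures that redefining a linear map on words longer than n does not affect its values on
relations of degree n. -/
theorem relSub_le_wordFil
    (hnil : ∀ g h, ρ (elt k g) (word k [] h) = word k [] (g * h))
    (hact : ∀ g v, ρ (elt k g) * vecOp b v =
      vecOp b (g • v) * ρ (elt k g) + ρ (lam (elt k g) v)) (n : ℕ) :
    relSub kap b ρ n ≤ wordFil k G ι n := by
  intro m hm
  change IsRel kap b ρ n m at hm
  induction hm with
  | rel u v hm =>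
    rw [relOp_apply, LinearMap.sub_apply, LinearMap.sub_apply, Module.End.mul_apply,
      Module.End.mul_apply]
    exact Submodule.sub_mem _ (Submodule.sub_mem _
      (vecOp_mem_wordFil b _ (vecOp_mem_wordFil b _ hm))
      (vecOp_mem_wordFil b _ (vecOp_mem_wordFil b _ hm)))
      (wordFil_mono (Nat.le_succ _) (kapOp_mem_wordFil b hnil hact _ _ hm))
  | vec v _ ih => exact vecOp_mem_wordFil b _ ih
  | zero => exact Submodule.zero_mem _
  | add _ _ ihx ihy => exact Submodule.add_mem _ ihx ihy
  | smul c _ ih => exact Submodule.smul_mem _ _ ih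
  | succ _ ih => exact wordFil_mono (Nat.le_succ _) ih

/-- The relations are generated by the commutation relations of basis vectors within words. -/
theorem apply_relSub_eq_zero {M : Type*} [AddCommGroup M] [Module k M] {l : ℕ}
    (N : WordModule k G ι →ₗ[k] M)
    (h : ∀ a i j c g, a.length + (c.length + 2) ≤ l →
      N (wordOp (fun i => vecOp b (b i)) a
        (relOp (E := WordEnd k G ι) kap (vecOp b) ρ (b i) (b j) (word k c g))) = 0)
    {m : WordModule k G ι} (hm : m ∈ relSub kap b ρ l) : N m = 0 := by
  -- The prefix `a` is generalized so that the constructor `vec` can be absorbed by appending one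
  -- letter to it.
  have key : ∀ n m, IsRel kap b ρ n m → ∀ a : List ι, a.length + n ≤ l →
      N (wordOp (fun i => vecOp b (b i)) a m) = 0 := by
    intro n m hm
    induction hm with
    | @rel u v n m hm =>
      intro a ha
      have h' : ∀ i j, wordFil k G ι n ≤ LinearMap.ker (N ∘ₗ
          wordOp (fun i => vecOp b (b i)) a ∘ₗ relOp (E := WordEnd k G ι) kap (vecOp b) ρ (b i) (b j)) :=
        fun i j => wordFil_induction fun w g hw => h a i j w g (by omega)
      have := apply_mem_of_basis b (S := LinearMap.ker (N ∘ₗ wordOp (fun i => vecOp b (b i)) a))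
        (m := m) ((relOp (E := WordEnd k G ι) kap (vecOp b) ρ).flip v) (fun i => apply_mem_of_basis b
          (S := LinearMap.ker (N ∘ₗ wordOp (fun i => vecOp b (b i)) a))
          (relOp (E := WordEnd k G ι) kap (vecOp b) ρ (b i)) (fun j => h' i j hm) v) u
      exact this
    | @vec v n m hm ih =>
      intro a ha
      refine apply_mem_of_basis b (S := LinearMap.ker (N ∘ₗ wordOp (fun i => vecOp b (b i)) a))
        (vecOp b) (fun i => ?_) v
      have := ih (a ++ [i]) (by simp only [List.length_append, List.length_singleton]; omega)
      simpa [wordOp_append, Module.End.mul_apply] using this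
    | zero => simp
    | add _ _ ihx ihy => intro a ha; rw [map_add, map_add, ihx a ha, ihy a ha, add_zero]
    | smul c _ ih => intro a ha; rw [map_smul, map_smul, ih a ha, smul_zero]
    | succ _ ih => intro a ha; exact ih a (by omega)
  simpa using key l m hm [] (by simp)

end Diamond

end DrinfeldOrbifold

namespace DrinfeldOrbifold

/-! ### Normal forms by induction on the degree -/

section NormalForm

variable {k G V ι : Type*} [Field k] [Group G] [Fintype G] [AddCommGroup V] [Module k V]
  [DistribMulAction G V] [SMulCommClass G k V] [LinearOrder ι]
  {lam : MonoidAlgebra k G →ₗ[k] V →ₗ[k] MonoidAlgebra k G}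
  {kap : V →ₗ[k] V →ₗ[k] MonoidAlgebra k G × (V ⊗[k] MonoidAlgebra k G)}
  (b : Module.Basis ι k V) {ρ : MonoidAlgebra k G →ₐ[k] WordEnd k G ι}

/-- By `hjac`, twice the cyclic sum is minus a sum of values of `relOp`, and 2 is invertible. The
point is the degree: n + 2 is one less than that of the words x y z m, so the induction hypothesis
of `exists_normalForm` applies. -/
theorem cyclic_commutator_mem_relSub (h2 : (2 : k) ≠ 0)
    (hnil : ∀ g h, ρ (elt k g) (word k [] h) = word k [] (g * h))
    (hact : ∀ g v, ρ (elt k g) * vecOp b v =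
      vecOp b (g • v) * ρ (elt k g) + ρ (lam (elt k g) v))
    (hjac : ∀ x y z, altSum (M := WordEnd k G ι) (fun x y z =>
      (2 : k) • (kapOp (E := WordEnd k G ι) kap (vecOp b) ρ x y * vecOp b z -
        vecOp b z * kapOp (E := WordEnd k G ι) kap (vecOp b) ρ x y) +
      ∑ a : G, relOp (E := WordEnd k G ι) kap (vecOp b) ρ (z + a • z) (kapLAt kap a x y) *
        ρ (elt k a)) x y z = 0)
    (x y z : V) {n : ℕ} {m : WordModule k G ι} (hm : m ∈ wordFil k G ι n) :
    altSum (M := WordEnd k G ι) (fun x y z => kapOp (E := WordEnd k G ι) kap (vecOp b) ρ x y * vecOp b z -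
        vecOp b z * kapOp (E := WordEnd k G ι) kap (vecOp b) ρ x y) x y z m ∈
      relSub kap b ρ (n + 2) := by
  rw [← Submodule.smul_mem_iff _ h2]
  have hR : ∀ x y z : V, (∑ a : G, relOp (E := WordEnd k G ι) kap (vecOp b) ρ (z + a • z)
      (kapLAt kap a x y) * ρ (elt k a)) m ∈ relSub kap b ρ (n + 2) := by
    intro x y z
    rw [LinearMap.sum_apply]
    refine Submodule.sum_mem _ fun a _ => ?_
    rw [Module.End.mul_apply]
    exact relOp_mem_relSub _ _ (groupOp_mem_wordFil b hnil hact _ hm)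
  have e := congrArg (fun f : WordEnd k G ι => f m) (hjac x y z)
  simp only [altSum, LinearMap.add_apply, LinearMap.smul_apply, LinearMap.zero_apply] at e ⊢
  have e' := Submodule.add_mem _ (Submodule.add_mem _ (hR x y z) (hR y z x)) (hR z x y)
  rw [← Submodule.neg_mem_iff] at e'
  convert e' using 1
  rw [eq_neg_iff_add_eq_zero, ← e]
  simp only [smul_add]
  abel

theorem kapOp_self_apply (hkap : ∀ v, kap v v = 0) (v : V) (m : WordModule k G ι) :
    kapOp (E := WordEnd k G ι) kap (vecOp b) ρ v v m = 0 := by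
  rw [kapOp_self (E := WordEnd k G ι) (vecOp b) ρ hkap, LinearMap.zero_apply]

theorem kapOp_swap_apply (hkap : ∀ v, kap v v = 0) (u v : V) (m : WordModule k G ι) :
    kapOp (E := WordEnd k G ι) kap (vecOp b) ρ u v m =
      - kapOp (E := WordEnd k G ι) kap (vecOp b) ρ v u m := by
  rw [kapOp_swap (E := WordEnd k G ι) (vecOp b) ρ hkap u v, LinearMap.neg_apply]
theorem vecOp_commutator_apply (u v : V) (m : WordModule k G ι) :
    vecOp b u (vecOp b v m) - vecOp b v (vecOp b u m) =
      relOp (E := WordEnd k G ι) kap (vecOp b) ρ u v m +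
      kapOp (E := WordEnd k G ι) kap (vecOp b) ρ u v m := by
  rw [relOp_apply (E := WordEnd k G ι), LinearMap.sub_apply, LinearMap.sub_apply,
    Module.End.mul_apply, Module.End.mul_apply, sub_add_cancel]

/-- By induction on the degree, there is a linear map that kills the relations and fixes the
sorted words. -/
theorem exists_normalForm (h2 : (2 : k) ≠ 0) (hkap : ∀ v, kap v v = 0)
    (hnil : ∀ g h, ρ (elt k g) (word k [] h) = word k [] (g * h))
    (hact : ∀ g v, ρ (elt k g) * vecOp b v =
      vecOp b (g • v) * ρ (elt k g) + ρ (lam (elt k g) v))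
    (hgrp : ∀ g u v, ρ (elt k g) * relOp (E := WordEnd k G ι) kap (vecOp b) ρ u v =
      relOp (E := WordEnd k G ι) kap (vecOp b) ρ (g • u) (g • v) * ρ (elt k g))
    (hjac : ∀ x y z, altSum (M := WordEnd k G ι) (fun x y z =>
      (2 : k) • (kapOp (E := WordEnd k G ι) kap (vecOp b) ρ x y * vecOp b z -
        vecOp b z * kapOp (E := WordEnd k G ι) kap (vecOp b) ρ x y) +
      ∑ a : G, relOp (E := WordEnd k G ι) kap (vecOp b) ρ (z + a • z) (kapLAt kap a x y) *
        ρ (elt k a)) x y z = 0) (n : ℕ) :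
    ∃ N : WordModule k G ι →ₗ[k] WordModule k G ι,
      (∀ w g, w.Pairwise (· ≤ ·) → N (word k w g) = word k w g) ∧
      ∀ m ∈ relSub kap b ρ n, N m = 0 := by
  induction n with
  | zero =>
    refine ⟨LinearMap.id, fun _ _ _ => rfl, fun m hm => ?_⟩
    exact apply_relSub_eq_zero b _ (fun a i j c g h => by omega) hm
  | succ n ih =>
    obtain ⟨N, hsorted, hrel⟩ := ih
    set K := kapOp (E := WordEnd k G ι) kap (vecOp b) ρ with hK
    set R := relOp (E := WordEnd k G ι) kap (vecOp b) ρ with hR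
    set W : List ι → WordEnd k G ι := wordOp (fun i => vecOp b (b i)) with hW
    -- The correction is needed only for words of length n + 1, where κ leaves degree at most n and
    -- `N` is already known. Setting it to zero for other lengths makes the cocycle conditions
    -- trivial there.
    let δ : G → List ι → ι → ι → List ι → WordModule k G ι := fun g a j i c =>
      if a.length + c.length + 1 = n then N (W a (K (b j) (b i) (word k c g))) else 0
    have hδ : ∀ g a j i c, a.length + c.length + 1 = n →
        δ g a j i c = N (W a (K (b j) (b i) (word k c g))) := fun g a j i c h => if_pos h
    have hδ' : ∀ g a j i c, ¬ a.length + c.length + 1 = n → δ g a j i c = 0 :=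
      fun g a j i c h => if_neg h
    have hKswap : ∀ i j m, K (b i) (b j) m = - K (b j) (b i) m :=
      fun i j m => kapOp_swap_apply b hkap _ _ m
    have hRK : ∀ i j m, vecOp b (b i) (vecOp b (b j) m) - vecOp b (b j) (vecOp b (b i) m) =
        R (b i) (b j) m + K (b i) (b j) m := fun i j m => vecOp_commutator_apply b _ _ m
    have hword : ∀ i c (g : G), word k (i :: c) g = vecOp b (b i) (word k c g) :=
      fun i c g => (vecOp_basis b i c g).symm
    have hWword : ∀ a c (g : G), word k (a ++ c) g = W a (word k c g) :=
      fun a c g => (wordOp_word b a c g).symm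
    have hWapp : ∀ a c m, W (a ++ c) m = W a (W c m) := fun a c m => by
      rw [hW, wordOp_append, Module.End.mul_apply]
    have hWcons : ∀ i c m, W (i :: c) m = vecOp b (b i) (W c m) := fun i c m => by
      rw [hW, wordOp_cons, Module.End.mul_apply]
    have hWnil : ∀ m, W [] m = m := fun m => by rw [hW, wordOp_nil, Module.End.one_apply]
    have cocycle : ∀ g, ∃ N' : List ι → WordModule k G ι,
        (∀ w, w.Pairwise (· ≤ ·) → N' w = word k w g) ∧
        ∀ a j i c, N' (a ++ j :: i :: c) = N' (a ++ i :: j :: c) + δ g a j i c := by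
      intro g
      apply exists_sort_cocycle (fun w => word k w g) (δ g)
      · intro a i c
        by_cases h : a.length + c.length + 1 = n
        · rw [hδ _ _ _ _ _ h, hK, kapOp_self_apply b hkap, map_zero, map_zero]
        · exact hδ' _ _ _ _ _ h
      · intro a i j c
        by_cases h : a.length + c.length + 1 = n
        · rw [hδ _ _ _ _ _ h, hδ _ _ _ _ _ h, hKswap j i, map_neg, map_neg]
        · rw [hδ' _ _ _ _ _ h, hδ' _ _ _ _ _ h, neg_zero]
      · intro a j i c l m d
        -- Both differences reduce to the value of `N` on the word with both pairs replaced by κ: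
        -- each remaining commutator is R + K, and the R terms are relations of degree n.
        by_cases h : a.length + c.length + d.length + 3 = n
        · have hr1 : W a (K (b j) (b i) (W c (R (b l) (b m) (word k d g)))) ∈
              relSub kap b ρ n := by
            refine relSub_mono kap b ρ (by omega) (wordOp_mem_relSub kap b ρ a
              (kapOp_mem_relSub b hnil hact hgrp (b j) (b i) (wordOp_mem_relSub kap b ρ c
              (relOp_mem_relSub (b l) (b m) (word_mem_wordFil le_rfl g)))))
          have hr2 : W a (R (b j) (b i) (W c (K (b l) (b m) (word k d g)))) ∈
              relSub kap b ρ n := by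
            refine relSub_mono kap b ρ (by omega) (wordOp_mem_relSub kap b ρ a
              (relOp_mem_relSub (b j) (b i) (wordOp_mem_wordFil b c
              (kapOp_mem_wordFil b hnil hact (b l) (b m) (word_mem_wordFil le_rfl g)))))
          rw [hδ _ _ _ _ _ (by simp only [List.length_append, List.length_cons]; omega),
            hδ _ _ _ _ _ (by simp only [List.length_append, List.length_cons]; omega),
            hδ _ _ _ _ _ (by simp only [List.length_append, List.length_cons]; omega),
            hδ _ _ _ _ _ (by simp only [List.length_append, List.length_cons]; omega)]
          simp only [hWapp, hWcons, hWword, hword]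
          rw [← map_sub, ← map_sub, ← map_sub, ← map_sub, hRK, ← map_sub, ← map_sub, hRK]
          simp only [map_add]
          rw [hrel _ hr1, hrel _ hr2]
        · rw [hδ', hδ', hδ', hδ', sub_zero]
          all_goals simp only [List.length_append, List.length_cons]; omega
      · intro a l j i c
        -- The six corrections combine to `N` of the cyclic sum of commutators [κ, letter], which is
        -- a relation of degree n.
        by_cases h : a.length + c.length + 2 = n
        · have hr := hrel _ (relSub_mono kap b ρ (by omega : a.length + (c.length + 2) ≤ n)
            (wordOp_mem_relSub kap b ρ a (cyclic_commutator_mem_relSub b h2 hnil hact hjac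
              (b l) (b j) (b i) (word_mem_wordFil (le_refl c.length) g))))
          rw [hδ _ _ _ _ _ (by simp only [List.length_cons]; omega),
            hδ _ _ _ _ _ (by simp only [List.length_append, List.length_singleton]; omega),
            hδ _ _ _ _ _ (by simp only [List.length_cons]; omega),
            hδ _ _ _ _ _ (by simp only [List.length_append, List.length_singleton]; omega),
            hδ _ _ _ _ _ (by simp only [List.length_cons]; omega),
            hδ _ _ _ _ _ (by simp only [List.length_append, List.length_singleton]; omega)]
          simp only [hWapp, hWcons, hWnil, hword]
          simp only [← hK, ← hW, altSum, hKswap i l, LinearMap.add_apply, LinearMap.sub_apply,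
            Module.End.mul_apply, map_add, map_sub, map_neg] at hr
          rw [← sub_eq_zero, ← hr]
          abel
        · rw [hδ', hδ', hδ', hδ', hδ', hδ']
          all_goals simp only [List.length_append, List.length_cons, List.length_nil]; omega
    choose N' hN'sorted hN' using cocycle
    -- The old map is kept up to length n; the sorted values take over above it.
    let N₁ : WordModule k G ι →ₗ[k] WordModule k G ι :=
      Finsupp.linearCombination k fun p : List ι × G =>
        if p.1.length ≤ n then N (word k p.1 p.2) else N' p.2 p.1
    have hN₁ : ∀ w g, w.length ≤ n → N₁ (word k w g) = N (word k w g) := by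
      intro w g h
      simp [N₁, h]
    have hN₁' : ∀ w g, ¬ w.length ≤ n → N₁ (word k w g) = N' g w := by
      intro w g h
      simp [N₁, h]
    have hN₁F : ∀ m ∈ wordFil k G ι n, N₁ m = N m := by
      intro m hm
      have : wordFil k G ι n ≤ LinearMap.eqLocus N₁ N := wordFil_induction fun w g hw => hN₁ w g hw
      exact this hm
    refine ⟨N₁, fun w g hw => ?_, fun m hm => apply_relSub_eq_zero b N₁ (fun a i j c g hl => ?_) hm⟩
    · by_cases h : w.length ≤ n
      · rw [hN₁ w g h, hsorted w g hw]
      · rw [hN₁' w g h, hN'sorted g w hw]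
    -- Only relations with leading words of length exactly n + 1 are new. For these the exchange
    -- rule of `N'` cancels the κ term.
    · rcases Nat.lt_or_ge n (a.length + (c.length + 2)) with hlt | hle
      · have hc : a.length + c.length + 1 = n := by omega
        have : W a (R (b i) (b j) (word k c g)) = word k (a ++ i :: j :: c) g -
            word k (a ++ j :: i :: c) g - W a (K (b i) (b j) (word k c g)) := by
          rw [hWword, hWword, hword, hword, hword, hword, ← map_sub, hRK, map_add, add_sub_cancel_right]
        rw [this, map_sub, map_sub, hN₁' _ _ (by simp only [List.length_append, List.length_cons]; omega),
          hN₁' _ _ (by simp only [List.length_append, List.length_cons]; omega),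
          hN₁F _ (wordFil_mono (by omega : a.length + (c.length + 1) ≤ n) (wordOp_mem_wordFil b a
            (kapOp_mem_wordFil b hnil hact _ _ (word_mem_wordFil le_rfl g)))),
          hN', hδ _ _ _ _ _ hc, add_sub_cancel_left, sub_self]
      · have : W a (R (b i) (b j) (word k c g)) ∈ relSub kap b ρ n :=
          relSub_mono kap b ρ hle (wordOp_mem_relSub kap b ρ a
            (relOp_mem_relSub _ _ (word_mem_wordFil le_rfl g)))
        rw [hN₁F _ (relSub_le_wordFil b hnil hact n this), hrel _ this]

end NormalForm

end DrinfeldOrbifold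

namespace DrinfeldOrbifold

/-! ### Polarizing quadratic relations of S(V) -/

section Polarization

variable {k V ι : Type*} [Field k] [AddCommGroup V] [Module k V] [Fintype ι]
  (b : Module.Basis ι k V)

/-- Partial derivatives read off coordinates of a linear form; two of them extract the symmetrized
coefficients of a product of two such forms. -/
theorem pderiv_equivMvPolynomial_ι (i : ι) (v : V) :
    MvPolynomial.pderiv i (SymmetricAlgebra.equivMvPolynomial b (SymmetricAlgebra.ι k V v)) =
      MvPolynomial.C (b.repr v i) := by
  classical
  have h : (MvPolynomial.pderiv i).toLinearMap ∘ₗ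
      (SymmetricAlgebra.equivMvPolynomial b).toLinearMap ∘ₗ SymmetricAlgebra.ι k V =
      Algebra.linearMap k (MvPolynomial ι k) ∘ₗ b.coord i := by
    refine b.ext fun j => ?_
    simp [SymmetricAlgebra.equivMvPolynomial_ι_apply, MvPolynomial.pderiv_X, Finsupp.single_apply,
      Pi.single_apply, apply_ite (MvPolynomial.C (σ := ι) (R := k))]
  exact LinearMap.congr_fun h v

/-- A quadratic relation in `S(V)` can be polarized. -/
theorem sum_polar_eq_zero (b : Module.Basis ι k V) {E κ : Type*} [AddCommGroup E] [Module k E]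
    (B : V →ₗ[k] V →ₗ[k] E)
    (s : Finset κ) (p q : κ → V)
    (h : ∑ t ∈ s, SymmetricAlgebra.ι k V (p t) * SymmetricAlgebra.ι k V (q t) = 0) :
    ∑ t ∈ s, (B (p t) (q t) + B (q t) (p t)) = 0 := by
  -- Apply ∂ᵢ∂ⱼ to the relation, viewed as a polynomial. The result is already symmetrized, so no
  -- division by 2 is needed.
  have hc : ∀ i j, ∑ t ∈ s, (b.repr (p t) i * b.repr (q t) j + b.repr (q t) i * b.repr (p t) j)
      = 0 := by
    intro i j
    have := congrArg (fun x => MvPolynomial.pderiv i (MvPolynomial.pderiv j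
      (SymmetricAlgebra.equivMvPolynomial b x))) h
    simp only [map_sum, map_mul, Derivation.leibniz, pderiv_equivMvPolynomial_ι, smul_eq_mul,
      map_add, MvPolynomial.pderiv_C, map_zero, mul_zero, zero_add] at this
    apply MvPolynomial.C_injective ι k
    rw [map_sum, map_zero, ← this]
    refine Finset.sum_congr rfl fun t _ => ?_
    simp only [map_add, map_mul]
    ring
  have hB : ∀ v w, B v w = ∑ i, ∑ j, (b.repr v i * b.repr w j) • B (b i) (b j) := by
    intro v w
    conv_lhs => rw [← b.sum_repr v, ← b.sum_repr w]
    simp only [map_sum, LinearMap.sum_apply, map_smul, LinearMap.smul_apply, Finset.smul_sum,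
      smul_smul]
    rw [Finset.sum_comm]
    exact Finset.sum_congr rfl fun i _ => Finset.sum_congr rfl fun j _ => by rw [mul_comm]
  have ht : ∀ t ∈ s, B (p t) (q t) + B (q t) (p t) = ∑ i, ∑ j, (b.repr (p t) i * b.repr (q t) j +
      b.repr (q t) i * b.repr (p t) j) • B (b i) (b j) := fun t _ => by
    rw [hB (p t), hB (q t)]
    simp only [← Finset.sum_add_distrib, ← add_smul]
  rw [Finset.sum_congr rfl ht, Finset.sum_comm]
  refine Finset.sum_eq_zero fun i _ => ?_
  rw [Finset.sum_comm]
  refine Finset.sum_eq_zero fun j _ => ?_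
  rw [← Finset.sum_smul, hc, zero_smul]

/-- Polarization is applied to the bilinear map (p, q) ↦ X p · X q, whose values need not commute.
-/
theorem altSum_jacobiPolar_eq_zero {G E : Type*} [Group G] [Fintype G] [DistribMulAction G V]
    [SMulCommClass G k V] [Ring E] [Algebra k E]
    {kap : V →ₗ[k] V →ₗ[k] MonoidAlgebra k G × (V ⊗[k] MonoidAlgebra k G)} (b : Module.Basis ι k V)
    (X : V →ₗ[k] E) {a : G} {x y z : V}
    (h : altSum (fun x y z => SymmetricAlgebra.ι k V (kapLAt kap a x y) *
      SymmetricAlgebra.ι k V (z - a • z)) x y z = 0) :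
    altSum (jacobiPolar kap X a) x y z = 0 := by
  have := sum_polar_eq_zero b ((LinearMap.mul k E).compl₁₂ X X) Finset.univ
    ![kapLAt kap a x y, kapLAt kap a y z, kapLAt kap a z x] ![z - a • z, x - a • x, y - a • y]
    (by simpa [Fin.sum_univ_three, altSum] using h)
  simpa [Fin.sum_univ_three, altSum, jacobiPolar] using this

end Polarization

/-! ### Linear independence of sorted monomials in H -/

section Independence

variable {k G V ι : Type*} [Field k] [Group G] [Fintype G] [AddCommGroup V] [Module k V]
  [DistribMulAction G V] 
  (lam : MonoidAlgebra k G →ₗ[k] V →ₗ[k] MonoidAlgebra k G)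
  (kap : V →ₗ[k] V →ₗ[k] MonoidAlgebra k G × (V ⊗[k] MonoidAlgebra k G))

theorem fromG_mul_fromV (g : G) (v : V) :
    fromG lam kap (elt k g) * fromV lam kap v =
      fromV lam kap (g • v) * fromG lam kap (elt k g) + fromG lam kap (lam (elt k g) v) := by
  have h := RingQuot.mkAlgHom_rel k (HRel.act (lam := lam) (kap := kap) g v)
  rw [map_add, map_mul, map_mul] at h
  exact h

theorem map_inVG {E : Type*} [Ring E] [Algebra k E] (f : FreeGV k G V →ₐ[k] E)
    (t : V ⊗[k] MonoidAlgebra k G) :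
    f (inVG t) = ∑ a : G, f (inV (coeffAt a t)) * f (inG (elt k a)) := by
  conv_lhs => rw [tensor_eq_sum_coeffAt t]
  simp [inVG]

theorem relOp_fromV (u v : V) : relOp kap (fromV lam kap) (fromG lam kap) u v = 0 := by
  have h := RingQuot.mkAlgHom_rel k (HRel.comm (lam := lam) (kap := kap) u v)
  rw [map_add, map_add, map_mul, map_mul, map_inVG] at h
  rw [relOp_apply, kapOp_apply, sub_sub, sub_eq_zero]
  exact h

/-- The map that multiplies out words in `H_{λ,κ}`. -/
noncomputable def toH (b : Module.Basis ι k V) : WordModule k G ι →ₗ[k] Hlk lam kap :=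
  Finsupp.linearCombination k fun p =>
    wordOp (fun i => fromV lam kap (b i)) p.1 * fromG lam kap (elt k p.2)

theorem toH_word (b : Module.Basis ι k V) (w : List ι) (g : G) :
    toH lam kap b (word k w g) =
      wordOp (fun i => fromV lam kap (b i)) w * fromG lam kap (elt k g) := by
  simp [toH]

/-- The operators induced on a quotient by a family of operators that preserve the subspace. -/
def quotientOp {W A : Type*} [AddCommGroup W] [Module k W] [AddCommGroup A] [Module k A]
    (J : Submodule k A) (T : W →ₗ[k] Module.End k A) (hT : ∀ w, J ≤ J.comap (T w)) :
    W →ₗ[k] Module.End k (A ⧸ J) where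
  toFun w := J.mapQ J (T w) (hT w)
  map_add' w w' := Submodule.linearMap_qext _ (by ext; simp)
  map_smul' c w := Submodule.linearMap_qext _ (by ext; simp)

variable {lam kap} [SMulCommClass G k V]

/-- Operators on a space that satisfy the relations of `H_{λ,κ}` modulo a subspace detect that
subspace. -/
theorem mem_of_toH_eq_zero (b : Module.Basis ι k V) {ρ : MonoidAlgebra k G →ₐ[k] WordEnd k G ι}
    (hnil : ∀ g h, ρ (elt k g) (word k [] h) = word k [] (g * h))
    (hact : ∀ g v, ρ (elt k g) * vecOp b v =
      vecOp b (g • v) * ρ (elt k g) + ρ (lam (elt k g) v))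
    (J : Submodule k (WordModule k G ι)) (hρJ : ∀ x, J ≤ J.comap (ρ x))
    (hXJ : ∀ v, J ≤ J.comap (vecOp b v))
    (hrel : ∀ u v m, relOp (E := WordEnd k G ι) kap (vecOp b) ρ u v m ∈ J)
    (m : WordModule k G ι) (hm : toH lam kap b m = 0) : m ∈ J := by
  let P := quotientOp J ρ.toLinearMap hρJ
  let Y := quotientOp J (vecOp b) hXJ
  let Φ : FreeGV k G V →ₐ[k] Module.End k (WordModule k G ι ⧸ J) :=
    TensorAlgebra.lift k (P.coprod Y)
  have hΦG : ∀ x, Φ (inG x) = P x := fun x => by simp [Φ, inG]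
  have hΦV : ∀ v, Φ (inV v) = Y v := fun v => by simp [Φ, inV]
  have hP : ∀ x m, P x (J.mkQ m) = J.mkQ (ρ x m) := fun x m => rfl
  have hY : ∀ v m, Y v (J.mkQ m) = J.mkQ (vecOp b v m) := fun x m => rfl
  have hΦ : ∀ ⦃x y⦄, HRel lam kap x y → Φ x = Φ y := by
    intro x y h
    refine Submodule.linearMap_qext _ (LinearMap.ext fun m => ?_)
    rw [LinearMap.comp_apply, LinearMap.comp_apply]
    induction h with
    | one => rw [hΦG, hP, map_one, map_one, Module.End.one_apply, Module.End.one_apply]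
    | mul x y => rw [map_mul Φ, hΦG, hΦG, hΦG, Module.End.mul_apply, hP, hP, hP, map_mul,
        Module.End.mul_apply]
    | act g v =>
      rw [map_add, map_mul, map_mul, hΦG, hΦG, hΦV, hΦV, LinearMap.add_apply,
        Module.End.mul_apply, Module.End.mul_apply, hP, hP, hY, hY, hP, ← map_add,
        ← Module.End.mul_apply, hact]
      rfl
    | comm u v =>
      have h := hrel u v m
      rw [relOp_apply (E := WordEnd k G ι), kapOp_apply (E := WordEnd k G ι),
        LinearMap.sub_apply, LinearMap.sub_apply, LinearMap.add_apply,
        Module.End.mul_apply, Module.End.mul_apply, LinearMap.sum_apply, sub_sub,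
        ← Submodule.Quotient.eq] at h
      rw [map_add, map_add, map_mul, map_mul, map_inVG, hΦV, hΦV, hΦG, LinearMap.add_apply,
        LinearMap.add_apply, LinearMap.sum_apply, Module.End.mul_apply, Module.End.mul_apply,
        hY, hY, hY, hY, hP]
      simp only [hΦV, hΦG, Module.End.mul_apply, hP, hY]
      rw [← map_sum, ← map_add, ← map_add]
      exact h
  let ψ : Hlk lam kap →ₐ[k] Module.End k (WordModule k G ι ⧸ J) := RingQuot.liftAlgHom k ⟨Φ, hΦ⟩
  have hψ : ∀ x, ψ (quo lam kap x) = Φ x := fun x => RingQuot.liftAlgHom_mkAlgHom_apply k Φ hΦ x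
  have hψG : ∀ x, ψ (fromG lam kap x) = P x := fun x => (hψ _).trans (hΦG x)
  have hψV : ∀ v, ψ (fromV lam kap v) = Y v := fun v => (hψ _).trans (hΦV v)
  have hψw : ∀ (w : List ι) m, ψ (wordOp (fun i => fromV lam kap (b i)) w) (J.mkQ m) =
      J.mkQ (wordOp (fun i => vecOp b (b i)) w m) := by
    intro w m
    induction w with
    | nil => simp
    | cons i w ih => rw [wordOp_cons, wordOp_cons, map_mul, Module.End.mul_apply, ih, hψV, hY,
        Module.End.mul_apply]
  -- Acting on the class of the empty word with group element 1 turns the product of a word in H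
  -- back into the class of that word.
  have key : (LinearMap.applyₗ (J.mkQ (word k [] 1))) ∘ₗ ψ.toLinearMap ∘ₗ toH lam kap b =
      J.mkQ := by
    refine wordModule_ext fun w g => ?_
    rw [LinearMap.comp_apply, LinearMap.comp_apply, toH_word]
    change ψ _ _ = _
    rw [map_mul, Module.End.mul_apply, hψG, hP, hψw, hnil, wordOp_word, List.append_nil, mul_one]
  have := LinearMap.congr_fun key m
  rw [LinearMap.comp_apply, LinearMap.comp_apply, hm, map_zero, map_zero] at this
  exact (Submodule.Quotient.mk_eq_zero _).1 this.symm

/-- The span of the sorted words whose length satisfies `P`. -/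
noncomputable def sortedSpan (k G ι : Type*) [Field k] [LinearOrder ι] (P : ℕ → Prop) :
    Submodule k (WordModule k G ι) :=
  Finsupp.supported k k {p : List ι × G | p.1.Pairwise (· ≤ ·) ∧ P p.1.length}

theorem sortedSpan_le [LinearOrder ι] {P : ℕ → Prop} {S : Submodule k (WordModule k G ι)}
    (h : ∀ w g, w.Pairwise (· ≤ ·) → P w.length → word k w g ∈ S) : sortedSpan k G ι P ≤ S := by
  rw [sortedSpan, Finsupp.supported_eq_span_single, Submodule.span_le]
  rintro _ ⟨p, ⟨h1, h2⟩, rfl⟩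
  exact h p.1 p.2 h1 h2

theorem word_mem_sortedSpan [LinearOrder ι] {P : ℕ → Prop} {w : List ι} (hw : w.Pairwise (· ≤ ·))
    (hP : P w.length) (g : G) : word k w g ∈ sortedSpan k G ι P :=
  Finsupp.single_mem_supported k 1 (Set.mem_ofPred.2 ⟨hw, hP⟩)

theorem sortedSpan_mono [LinearOrder ι] {P Q : ℕ → Prop} (h : ∀ n, P n → Q n) :
    sortedSpan k G ι P ≤ sortedSpan k G ι Q :=
  sortedSpan_le fun _ g hw hP => word_mem_sortedSpan hw (h _ hP) g

theorem eq_zero_of_mem_sortedSpan [LinearOrder ι] {P Q : ℕ → Prop} (h : ∀ n, P n → ¬ Q n)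
    {m : WordModule k G ι} (hP : m ∈ sortedSpan k G ι P) (hQ : m ∈ sortedSpan k G ι Q) : m = 0 :=
  Submodule.disjoint_def.1 (Finsupp.disjoint_supported_supported
    (Set.disjoint_left.2 fun _ hp hq => h _ hp.2 hq.2)) m hP hQ

/-- Under the conditions of the theorem, the sorted monomials are linearly independent in
`H_{λ,κ}`. -/
theorem eq_zero_of_toH_eq_zero [LinearOrder ι] [Fintype ι] (b : Module.Basis ι k V)
    (h2 : (2 : k) ≠ 0) (hkap : ∀ v, kap v v = 0)
    (h1 : ∀ (g h : G) (v : V),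
      lam (elt k (g * h)) v = lam (elt k g) (h • v) * elt k h + elt k g * lam (elt k h) v)
    (hg : ∀ (g : G) (u v : V), groupDefect lam kap g u v = 0)
    (hv : ∀ (g h : G) (u v : V), vecDefect lam kap g h u v = 0)
    (hjv : ∀ (g : G) (x y z : V), altSum (jacobiVec lam kap g) x y z = 0)
    (hjg : ∀ (x y z : V), altSum (jacobiGroup lam kap) x y z = 0)
    (hs : ∀ (g : G) (x y z : V), altSum (fun x y z => SymmetricAlgebra.ι k V (kapLAt kap g x y) *
      SymmetricAlgebra.ι k V (z - g • z)) x y z = 0)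
    {m : WordModule k G ι} {P : ℕ → Prop}
    (hm : m ∈ sortedSpan k G ι P) (h0 : toH lam kap b m = 0) : m = 0 := by
  set ρ : MonoidAlgebra k G →ₐ[k] WordEnd k G ι := groupAlgOp b h1 with hρ
  have hnil : ∀ g h : G, ρ (elt k g) (word k [] h) = word k [] (g * h) :=
    fun g h => groupOp_elt lam b g [] h
  have hact : ∀ g v, ρ (elt k g) * vecOp b v =
      vecOp b (g • v) * ρ (elt k g) + ρ (lam (elt k g) v) := groupOp_mul_vecOp lam b
  have hgrp : ∀ g u v, ρ (elt k g) * relOp (E := WordEnd k G ι) kap (vecOp b) ρ u v =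
      relOp (E := WordEnd k G ι) kap (vecOp b) ρ (g • u) (g • v) * ρ (elt k g) := by
    intro g u v
    rw [← sub_eq_zero, elt_mul_relOp (E := WordEnd k G ι) kap hact]
    simp [hg, hv]
  have hjac : ∀ x y z, altSum (M := WordEnd k G ι) (fun x y z =>
      (2 : k) • (kapOp (E := WordEnd k G ι) kap (vecOp b) ρ x y * vecOp b z -
        vecOp b z * kapOp (E := WordEnd k G ι) kap (vecOp b) ρ x y) +
      ∑ a : G, relOp (E := WordEnd k G ι) kap (vecOp b) ρ (z + a • z) (kapLAt kap a x y) *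
        ρ (elt k a)) x y z = 0 := by
    intro x y z
    exact altSum_commutator_kapOp_eq_zero (E := WordEnd k G ι) kap hact
      (fun a => altSum_jacobiPolar_eq_zero b _ (hs a x y z)) (fun g => hjv g x y z) (hjg x y z)
  have hmono := relSub_mono kap b ρ
  have hmem : ∀ {m}, m ∈ ⨆ n, relSub kap b ρ n ↔ ∃ n, m ∈ relSub kap b ρ n :=
    Submodule.mem_iSup_of_directed _ hmono.directed_le
  have hJ : m ∈ ⨆ n, relSub kap b ρ n := by
    refine mem_of_toH_eq_zero b hnil hact _ (fun x m hm => ?_) (fun v m hm => ?_)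
      (fun u v m => ?_) m h0
    · obtain ⟨n, hn⟩ := hmem.1 hm
      exact hmem.2 ⟨n, groupOp_mem_relSub b hnil hact hgrp x hn⟩
    · obtain ⟨n, hn⟩ := hmem.1 hm
      exact hmem.2 ⟨n + 1, vecOp_mem_relSub kap b ρ v hn⟩
    · obtain ⟨n, hn⟩ := exists_mem_wordFil m
      exact hmem.2 ⟨n + 2, relOp_mem_relSub u v hn⟩
  obtain ⟨n, hn⟩ := hmem.1 hJ
  obtain ⟨N, hN, hN0⟩ := exists_normalForm b h2 hkap hnil hact hgrp hjac n
  -- The vector is fixed by `N` as a combination of sorted words and killed by it as a relation.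
  have hid : sortedSpan k G ι P ≤ LinearMap.eqLocus N LinearMap.id :=
    sortedSpan_le fun w g hw _ => hN w g hw
  rw [← hN0 m hn]
  exact (hid hm).symm

end Independence

end DrinfeldOrbifold

namespace FilteredAlg

/-! ### Classes in the associated graded algebra -/

section Graded

variable {k A : Type*} [CommRing k] [Ring A] [Algebra k A]
variable (F : ℕ → Submodule k A)

/-- The class of an element of `F n`, in the associated graded algebra. -/
noncomputable def grOf (n : ℕ) : F n →ₗ[k] Gr F :=
  DirectSum.lof k ℕ (GrPiece F) n ∘ₗ grMk F n

theorem grOf_eq_zero {n : ℕ} (x : F n) : grOf F n x = 0 ↔ (x : A) ∈ below F n := by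
  rw [← grMk_eq_zero, grOf, LinearMap.comp_apply]
  exact map_eq_zero_iff (DirectSum.lof k ℕ (GrPiece F) n) (DirectSum.of_injective n)

theorem grOf_congr {i j : ℕ} (h : i = j) (x : F i) (y : F j) (hxy : (x : A) = y) :
    grOf F i x = grOf F j y := by
  subst h
  rw [Subtype.ext hxy]

theorem grOf_eq_of_sub_mem {n : ℕ} (x y : F n) (h : (x : A) - y ∈ below F n) :
    grOf F n x = grOf F n y := by
  rw [← sub_eq_zero, ← map_sub, grOf_eq_zero]
  exact h

theorem range_grOf (n : ℕ) :
    LinearMap.range (grOf F n) = LinearMap.range (DirectSum.lof k ℕ (GrPiece F) n) := by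
  rw [grOf, LinearMap.range_comp_of_range_eq_top]
  exact LinearMap.range_eq_top.2 (grMk_surjective F n)

theorem grOf_mul [SetLike.GradedMonoid F] {i j : ℕ} (x : F i) (y : F j) :
    grOf F i x * grOf F j y =
      grOf F (i + j) ⟨(x : A) * y, SetLike.mul_mem_graded x.2 y.2⟩ :=
  DirectSum.of_mul_of (A := GrPiece F) _ _

theorem grOf_mul_eq [SetLike.GradedMonoid F] {i j i' j' : ℕ} (x : F i) (y : F j) (x' : F i')
    (y' : F j') (hij : i + j = i' + j') (h : (x : A) * y - x' * y' ∈ below F (i + j)) :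
    grOf F i x * grOf F j y = grOf F i' x' * grOf F j' y' := by
  have h' : (x' : A) * y' ∈ F (i + j) := hij ▸ SetLike.mul_mem_graded x'.2 y'.2
  rw [grOf_mul, grOf_mul, ← grOf_congr F hij ⟨_, h'⟩ ⟨_, SetLike.mul_mem_graded x'.2 y'.2⟩ rfl]
  exact grOf_eq_of_sub_mem F _ _ h

theorem grOf_one [SetLike.GradedMonoid F] : grOf F 0 ⟨1, SetLike.one_mem_graded F⟩ = 1 := rfl

theorem le_below {i n : ℕ} (h : i < n) : F i ≤ below F n :=
  le_iSup₂_of_le (f := fun m (_ : m < n) => F m) i h le_rfl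

theorem wordFiltration_mono (B : Subalgebra k A) (W : Submodule k A) :
    Monotone (wordFiltration B W) := fun _ _ h =>
  iSup₂_le fun i hi => le_iSup₂_of_le (f := fun m (_ : m ≤ _) =>
    Subalgebra.toSubmodule B * (W * Subalgebra.toSubmodule B) ^ m) i (hi.trans h) le_rfl

theorem mem_wordFiltration_zero (B : Subalgebra k A) (W : Submodule k A) {x : A} (hx : x ∈ B) :
    x ∈ wordFiltration B W 0 := by
  refine (le_iSup₂_of_le (f := fun m (_ : m ≤ 0) =>
      Subalgebra.toSubmodule B * (W * Subalgebra.toSubmodule B) ^ m) 0 le_rfl le_rfl) ?_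
  rwa [pow_zero, mul_one]

theorem mem_wordFiltration_one (B : Subalgebra k A) (W : Submodule k A) {x : A} (hx : x ∈ W) :
    x ∈ wordFiltration B W 1 := by
  refine (le_iSup₂_of_le (f := fun m (_ : m ≤ 1) =>
      Subalgebra.toSubmodule B * (W * Subalgebra.toSubmodule B) ^ m) 1 le_rfl le_rfl) ?_
  rw [pow_one, ← one_mul x, ← mul_one x]
  exact Submodule.mul_mem_mul B.one_mem (Submodule.mul_mem_mul hx B.one_mem)

end Graded

end FilteredAlg

/-! ### The canonical map from S(V) ⋊ G to the associated graded algebra -/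

namespace DrinfeldOrbifold

open FilteredAlg

/-- A linear map to an algebra with commuting values extends to the symmetric algebra. -/
theorem exists_symmetricAlgebra_lift {k V A : Type*} [Field k] [AddCommGroup V] [Module k V]
    [Ring A] [Algebra k A] (f : V →ₗ[k] A) (h : ∀ v w, f v * f w = f w * f v) :
    ∃ φ : SymmetricAlgebra k V →ₐ[k] A, ∀ v, φ (SymmetricAlgebra.ι k V v) = f v := by
  -- The universal property of the symmetric algebra needs a commutative target, so `f` is
  -- corestricted to the subalgebra generated by its image.
  have hc : IsMulCommutative (Algebra.adjoin k (Set.range f)) :=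
    Algebra.isMulCommutative_adjoin k (by
      rintro _ ⟨v, rfl⟩ _ ⟨w, rfl⟩
      exact h v w)
  let : CommRing (Algebra.adjoin k (Set.range f)) :=
    { Subalgebra.toRing (Algebra.adjoin k (Set.range f)) with mul_comm := hc.is_comm.comm }
  let f' : V →ₗ[k] Algebra.adjoin k (Set.range f) :=
    f.codRestrict (Subalgebra.toSubmodule (Algebra.adjoin k (Set.range f)))
      fun v => Algebra.subset_adjoin ⟨v, rfl⟩
  refine ⟨(Algebra.adjoin k (Set.range f)).val.comp (SymmetricAlgebra.lift f'), fun v => ?_⟩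
  rw [AlgHom.comp_apply, SymmetricAlgebra.lift_ι_apply]
  rfl

section Canonical

variable {k G V ι : Type*} [Field k] [Group G] [Fintype G] [AddCommGroup V] [Module k V]
  [DistribMulAction G V]
  (lam : MonoidAlgebra k G →ₗ[k] V →ₗ[k] MonoidAlgebra k G)
  (kap : V →ₗ[k] V →ₗ[k] MonoidAlgebra k G × (V ⊗[k] MonoidAlgebra k G))

theorem fromG_mem (x : MonoidAlgebra k G) : fromG lam kap x ∈ filtration lam kap 0 :=
  mem_wordFiltration_zero _ _ ⟨x, rfl⟩

theorem fromV_mem (v : V) : fromV lam kap v ∈ filtration lam kap 1 :=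
  mem_wordFiltration_one _ _ ⟨v, rfl⟩

theorem filtration_mono : Monotone (filtration lam kap) := wordFiltration_mono _ _

/-- The degree `1` elements of the associated graded algebra given by vectors. -/
noncomputable def grV : V →ₗ[k] Gr (filtration lam kap) :=
  grOf (filtration lam kap) 1 ∘ₗ (fromV lam kap).codRestrict _ (fromV_mem lam kap)

theorem grV_apply (v : V) :
    grV lam kap v = grOf (filtration lam kap) 1 ⟨fromV lam kap v, fromV_mem lam kap v⟩ := rfl

/-- The degree `0` elements of the associated graded algebra given by elements of `G`. -/
noncomputable def grG : G →* Gr (filtration lam kap) where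
  toFun g := grOf (filtration lam kap) 0 ⟨fromG lam kap (elt k g), fromG_mem lam kap _⟩
  map_one' := (grOf_congr _ rfl _ _ ((congrArg _ elt_one).trans (map_one _))).trans (grOf_one _)
  map_mul' g h := by
    rw [grOf_mul]
    exact grOf_congr _ rfl _ _ ((congrArg _ (elt_mul g h)).trans (map_mul _ _ _))

theorem grG_apply (g : G) : grG lam kap g =
    grOf (filtration lam kap) 0 ⟨fromG lam kap (elt k g), fromG_mem lam kap _⟩ := rfl

theorem fromV_mul_fromG_mem (v : V) (x : MonoidAlgebra k G) :
    fromV lam kap v * fromG lam kap x ∈ filtration lam kap 1 := by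
  have := SetLike.mul_mem_graded (A := filtration lam kap) (fromV_mem lam kap v)
    (fromG_mem lam kap x)
  rwa [add_zero] at this

theorem kapOp_fromV_mem (u v : V) :
    kapOp kap (fromV lam kap) (fromG lam kap) u v ∈ filtration lam kap 1 := by
  rw [kapOp_apply]
  exact Submodule.add_mem _ (filtration_mono lam kap zero_le_one (fromG_mem lam kap _))
    (Submodule.sum_mem _ fun a _ => fromV_mul_fromG_mem lam kap _ _)

/-- The commutator is κ(v, w), which has filtration degree 1 and so dies in degree 2. -/
theorem grV_mul_comm (v w : V) :
    grV lam kap v * grV lam kap w = grV lam kap w * grV lam kap v := by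
  rw [grV_apply, grV_apply]
  refine grOf_mul_eq _ _ _ _ _ rfl ?_
  have h := relOp_fromV lam kap v w
  rw [relOp_apply, sub_eq_zero] at h
  rw [h]
  exact le_below _ (show 1 < 1 + 1 by omega) (kapOp_fromV_mem lam kap v w)

theorem grG_mul_grV (g : G) (v : V) :
    grG lam kap g * grV lam kap v = grV lam kap (g • v) * grG lam kap g := by
  rw [grV_apply, grV_apply, grG_apply]
  refine grOf_mul_eq _ _ _ _ _ rfl ?_
  rw [fromG_mul_fromV, add_sub_cancel_left]
  exact le_below _ (show 0 < 0 + 1 by omega) (fromG_mem lam kap _)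

variable [SMulCommClass G k V]

/-- The canonical map from the skew group algebra to the associated graded algebra. -/
theorem exists_canonical : ∃ Θ : SkewGroupAlgebra k G V →ₐ[k] Gr (filtration lam kap),
    (∀ v, Θ (SkewMonoidAlgebra.single 1 (SymmetricAlgebra.ι k V v)) = grV lam kap v) ∧
    ∀ g, Θ (SkewMonoidAlgebra.single g 1) = grG lam kap g := by
  obtain ⟨φ, hφ⟩ := exists_symmetricAlgebra_lift (grV lam kap) (grV_mul_comm lam kap)
  have hcomm : ∀ (g : G) (x : SymmetricAlgebra k V),
      φ (g • x) * grG lam kap g = grG lam kap g * φ x := by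
    intro g x
    induction x using SymmetricAlgebra.induction with
    | algebraMap r =>
      have : g • algebraMap k (SymmetricAlgebra k V) r = algebraMap k _ r := smul_algebraMap g r
      rw [this, AlgHom.commutes, Algebra.commutes]
    | ι v =>
      have : g • SymmetricAlgebra.ι k V v = SymmetricAlgebra.ι k V (g • v) := symAct_ι k G V g v
      rw [this, hφ, hφ, grG_mul_grV]
    | mul x y hx hy => rw [smul_mul', map_mul, map_mul, mul_assoc, hy, ← mul_assoc, hx, mul_assoc]
    | add x y hx hy => rw [smul_add, map_add, map_add, add_mul, mul_add, hx, hy]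
  refine ⟨SkewMonoidAlgebra.liftNCAlgHom φ (grG lam kap) fun {x y} => hcomm y x, fun v => ?_,
    fun g => ?_⟩
  · change SkewMonoidAlgebra.liftNC _ _ _ = _
    rw [SkewMonoidAlgebra.liftNC_single]
    simp [hφ]
  · change SkewMonoidAlgebra.liftNC _ _ _ = _
    rw [SkewMonoidAlgebra.liftNC_single]
    simp

end Canonical

end DrinfeldOrbifold

namespace DrinfeldOrbifold

open FilteredAlg

/-! ### Sorted words in H and in S(V) ⋊ G -/

section Comparison

variable {k G V ι : Type*} [Field k] [Group G] [Fintype G] [AddCommGroup V] [Module k V]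
  [DistribMulAction G V]
  (lam : MonoidAlgebra k G →ₗ[k] V →ₗ[k] MonoidAlgebra k G)
  (kap : V →ₗ[k] V →ₗ[k] MonoidAlgebra k G × (V ⊗[k] MonoidAlgebra k G))
  (b : Module.Basis ι k V)

theorem wordOp_fromV_mem (w : List ι) :
    wordOp (fun i => fromV lam kap (b i)) w ∈ filtration lam kap w.length := by
  induction w with
  | nil => exact SetLike.one_mem_graded (filtration lam kap)
  | cons i w ih =>
    rw [wordOp_cons, List.length_cons, add_comm]
    exact SetLike.mul_mem_graded (A := filtration lam kap) (fromV_mem lam kap _) ih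

theorem toH_word_mem (w : List ι) (g : G) :
    toH lam kap b (word k w g) ∈ filtration lam kap w.length := by
  rw [toH_word]
  have := SetLike.mul_mem_graded (A := filtration lam kap) (wordOp_fromV_mem lam kap b w)
    (fromG_mem lam kap (elt k g))
  rwa [add_zero] at this

theorem wordFil_le_comap_toH (n : ℕ) :
    wordFil k G ι n ≤ (filtration lam kap n).comap (toH lam kap b) :=
  wordFil_induction fun w g hw => filtration_mono lam kap hw (toH_word_mem lam kap b w g)

/-- A group element standing before the new vector is moved to the right; the λ term this creates
has no new vector, so words grow by at most one letter. -/
theorem toH_mul_mem {n : ℕ} {x : Hlk lam kap} (hx : x ∈ (wordFil k G ι n).map (toH lam kap b))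
    (v : V) (y : MonoidAlgebra k G) :
    x * (fromV lam kap v * fromG lam kap y) ∈ (wordFil k G ι (n + 1)).map (toH lam kap b) := by
  obtain ⟨m, hm, rfl⟩ := hx
  set S := (wordFil k G ι (n + 1)).map (toH lam kap b) with hS
  have hword : ∀ w g, w.length ≤ n + 1 → toH lam kap b (word k w g) ∈ S :=
    fun w g hw => Submodule.mem_map_of_mem (word_mem_wordFil hw g)
  have hG : ∀ (w : List ι) (z : MonoidAlgebra k G), w.length ≤ n + 1 →
      wordOp (fun i => fromV lam kap (b i)) w * fromG lam kap z ∈ S := by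
    intro w z hw
    rw [map_eq_sum (fromG lam kap) z, Finset.mul_sum]
    refine Submodule.sum_mem _ fun a _ => ?_
    rw [mul_smul_comm, ← toH_word]
    exact Submodule.smul_mem _ _ (hword w a hw)
  have hVG : ∀ (w : List ι) (u : V) (z : MonoidAlgebra k G), w.length ≤ n →
      wordOp (fun i => fromV lam kap (b i)) w * (fromV lam kap u * fromG lam kap z) ∈ S := by
    intro w u z hw
    have : (⊤ : Submodule k V) ≤ S.comap ((LinearMap.mulLeft k
        (wordOp (fun i => fromV lam kap (b i)) w)) ∘ₗ (LinearMap.mulRight k (fromG lam kap z)) ∘ₗ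
        fromV lam kap) := by
      rw [← b.span_eq, Submodule.span_le]
      rintro _ ⟨i, rfl⟩
      have := hG (w ++ [i]) z (by simpa using hw)
      rw [wordOp_append, wordOp_cons, wordOp_nil, mul_one, mul_assoc] at this
      exact this
    exact this Submodule.mem_top
  have key : wordFil k G ι n ≤ S.comap ((LinearMap.mulRight k
      (fromV lam kap v * fromG lam kap y)) ∘ₗ toH lam kap b) := by
    refine wordFil_induction fun w g hw => ?_
    rw [Submodule.mem_comap, LinearMap.comp_apply, LinearMap.mulRight_apply, toH_word, mul_assoc,
      ← mul_assoc (fromG _ _ _), fromG_mul_fromV, add_mul, mul_add, mul_assoc, ← map_mul, ← map_mul]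
    exact Submodule.add_mem _ (hVG w _ _ hw) (hG w _ (by omega))
  exact key hm

theorem filtration_le_map_toH (n : ℕ) :
    filtration lam kap n ≤ (wordFil k G ι n).map (toH lam kap b) := by
  refine iSup₂_le fun i hi => le_trans ?_ (Submodule.map_mono (wordFil_mono hi))
  clear hi
  induction i with
  | zero =>
    rw [pow_zero, mul_one]
    rintro _ ⟨x, rfl⟩
    change fromG lam kap x ∈ _
    rw [map_eq_sum (fromG lam kap) x]
    refine Submodule.sum_mem _ fun a _ => Submodule.smul_mem _ _
      ⟨word k [] a, word_mem_wordFil (by simp) a, ?_⟩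
    rw [toH_word, wordOp_nil, one_mul]
  | succ i ih =>
    rw [pow_succ, ← mul_assoc]
    refine Submodule.mul_le.2 fun x hx y hy => ?_
    have : LinearMap.range (fromV lam kap) * Subalgebra.toSubmodule (fromG lam kap).range ≤
        ((wordFil k G ι (i + 1)).map (toH lam kap b)).comap (LinearMap.mulLeft k x) := by
      refine Submodule.mul_le.2 ?_
      rintro _ ⟨v, rfl⟩ _ ⟨z, rfl⟩
      exact toH_mul_mem lam kap b (ih hx) v z
    exact this hy

variable [SMulCommClass G k V]

/-- The map that multiplies out words in the skew group algebra. -/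
noncomputable def toSkew : WordModule k G ι →ₗ[k] SkewGroupAlgebra k G V :=
  Finsupp.linearCombination k fun p =>
    SkewMonoidAlgebra.single p.2 (wordOp (fun i => SymmetricAlgebra.ι k V (b i)) p.1)

theorem toSkew_word (w : List ι) (g : G) : toSkew b (word k w g) =
    SkewMonoidAlgebra.single g (wordOp (fun i => SymmetricAlgebra.ι k V (b i)) w) := by
  simp [toSkew]

theorem toSkew_word_of_perm {w w' : List ι} (h : w.Perm w') (g : G) :
    toSkew b (word k w g) = toSkew b (word k w' g) := by
  rw [toSkew_word, toSkew_word, wordOp, wordOp, (h.map _).prod_eq]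

variable {lam kap}

/-- The homomorphism from the skew group algebra to the associated graded algebra is the canonical
one. -/
def IsCanonical (Θ : SkewGroupAlgebra k G V →ₐ[k] Gr (filtration lam kap)) : Prop :=
  (∀ v, Θ (SkewMonoidAlgebra.single 1 (SymmetricAlgebra.ι k V v)) = grV lam kap v) ∧
    ∀ g, Θ (SkewMonoidAlgebra.single g 1) = grG lam kap g

variable {Θ : SkewGroupAlgebra k G V →ₐ[k] Gr (filtration lam kap)}

theorem canonical_toSkew_word (hΘ : IsCanonical Θ) (w : List ι) (g : G) : Θ (toSkew b (word k w g)) =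
    grOf (filtration lam kap) w.length ⟨toH lam kap b (word k w g), toH_word_mem lam kap b w g⟩ := by
  induction w with
  | nil =>
    rw [toSkew_word, wordOp_nil, hΘ.2, grG_apply]
    exact grOf_congr _ rfl _ _ (by simp [toH_word])
  | cons i w ih =>
    rw [toSkew_word] at ih
    have : toSkew b (word k (i :: w) g) =
        SkewMonoidAlgebra.single 1 (SymmetricAlgebra.ι k V (b i)) *
        SkewMonoidAlgebra.single g (wordOp (fun i => SymmetricAlgebra.ι k V (b i)) w) := by
      rw [toSkew_word, wordOp_cons, SkewMonoidAlgebra.single_mul_single, one_mul, one_smul]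
    rw [this, map_mul, hΘ.1, ih, grV_apply, grOf_mul]
    refine grOf_congr _ (by rw [List.length_cons, add_comm]) _ _ ?_
    change fromV lam kap (b i) * toH lam kap b (word k w g) = toH lam kap b (word k (i :: w) g)
    rw [toH_word, toH_word, wordOp_cons, mul_assoc]

variable [LinearOrder ι]

theorem toSkew_mem_skewDeg (n : ℕ) :
    (sortedSpan k G ι (· = n)).map (toSkew b) ≤ skewDeg k G V n := by
  rw [Submodule.map_le_iff_le_comap]
  refine sortedSpan_le fun w g hsorted hw => ?_
  clear hsorted
  rw [Submodule.mem_comap, toSkew_word]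
  intro a
  rw [SkewMonoidAlgebra.coeff_single]
  by_cases h : g = a
  · subst h
    rw [Finsupp.single_eq_same, ← hw]
    clear hw
    induction w with
    | nil => simp
    | cons i w ih =>
      rw [wordOp_cons, List.length_cons, pow_succ']
      exact Submodule.mul_mem_mul ⟨b i, rfl⟩ ih
  · rw [Finsupp.single_eq_of_ne (Ne.symm h)]
    exact Submodule.zero_mem _

theorem single_mem_map_toSkew {n : ℕ} {s : SymmetricAlgebra k V}
    (hs : s ∈ LinearMap.range (SymmetricAlgebra.ι k V) ^ n) (g : G) :
    SkewMonoidAlgebra.single g s ∈ (sortedSpan k G ι (· = n)).map (toSkew b) := by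
  have hspan : ∀ n, LinearMap.range (SymmetricAlgebra.ι k V) ^ n ≤ Submodule.span k
      {s | ∃ w : List ι, w.length = n ∧ s = wordOp (fun i => SymmetricAlgebra.ι k V (b i)) w} := by
    intro n
    induction n with
    | zero =>
      rw [pow_zero, Submodule.one_eq_span, Submodule.span_le, Set.singleton_subset_iff]
      exact Submodule.subset_span ⟨[], rfl, rfl⟩
    | succ n ih =>
      have hr : LinearMap.range (SymmetricAlgebra.ι k V) =
          Submodule.span k (Set.range fun i => SymmetricAlgebra.ι k V (b i)) := by
        rw [LinearMap.range_eq_map, ← b.span_eq, Submodule.map_span, ← Set.range_comp]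
        rfl
      rw [pow_succ']
      refine (mul_le_mul' hr.le ih).trans ?_
      rw [Submodule.span_mul_span, Submodule.span_le]
      rintro _ ⟨_, ⟨i, rfl⟩, _, ⟨w, hw, rfl⟩, rfl⟩
      exact Submodule.subset_span ⟨i :: w, by simp [hw], by simp⟩
  let T : SymmetricAlgebra k V →ₗ[k] SkewGroupAlgebra k G V :=
    { toFun := SkewMonoidAlgebra.single g
      map_add' := SkewMonoidAlgebra.single_add g
      map_smul' := fun c x => (SkewMonoidAlgebra.smul_single c g x).symm }
  have : Submodule.span k {s | ∃ w : List ι, w.length = n ∧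
      s = wordOp (fun i => SymmetricAlgebra.ι k V (b i)) w} ≤
      ((sortedSpan k G ι (· = n)).map (toSkew b)).comap T := by
    rw [Submodule.span_le]
    rintro _ ⟨w, hw, rfl⟩
    change SkewMonoidAlgebra.single g (wordOp (fun i => SymmetricAlgebra.ι k V (b i)) w) ∈
      (sortedSpan k G ι (· = n)).map (toSkew b)
    rw [← toSkew_word, toSkew_word_of_perm b (List.perm_insertionSort (· ≤ ·) w).symm]
    exact Submodule.mem_map_of_mem (word_mem_sortedSpan (List.pairwise_insertionSort _ w)
      (by rw [List.length_insertionSort, hw]) g)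
  exact this (hspan n hs)

theorem map_toSkew (n : ℕ) :
    (sortedSpan k G ι (· = n)).map (toSkew b) = skewDeg k G V n := by
  refine le_antisymm (toSkew_mem_skewDeg b n) fun f hf => ?_
  rw [← SkewMonoidAlgebra.sum_single f, SkewMonoidAlgebra.sum_def, Finsupp.sum]
  refine sum_mem fun g _ => ?_
  exact single_mem_map_toSkew b (hf g) g

/-- On combinations of sorted words of length `n`, the canonical map is given by classes in degree
`n`. -/
theorem canonical_toSkew (hΘ : IsCanonical Θ) {n : ℕ} {m : WordModule k G ι}
    (hm : m ∈ sortedSpan k G ι (· = n)) (hm' : toH lam kap b m ∈ filtration lam kap n) :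
    Θ (toSkew b m) = grOf (filtration lam kap) n ⟨toH lam kap b m, hm'⟩ := by
  let T : wordFil k G ι n →ₗ[k] filtration lam kap n :=
    (toH lam kap b).restrict (wordFil_le_comap_toH lam kap b n)
  have hle : sortedSpan k G ι (· = n) ≤ wordFil k G ι n :=
    sortedSpan_le fun w g _ hw => word_mem_wordFil hw.le g
  -- The class in degree n is defined only on elements of the n-th step, so the two maps are
  -- compared on `wordFil` and the result is pushed forward.
  have key : sortedSpan k G ι (· = n) ≤ (LinearMap.eqLocus
      (Θ.toLinearMap ∘ₗ toSkew b ∘ₗ (wordFil k G ι n).subtype)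
      (grOf (filtration lam kap) n ∘ₗ T)).map (wordFil k G ι n).subtype :=
    sortedSpan_le fun w g _ hw => ⟨⟨word k w g, word_mem_wordFil hw.le g⟩,
      (canonical_toSkew_word b hΘ w g).trans (grOf_congr _ hw _ _ rfl), rfl⟩
  obtain ⟨x, hx, rfl⟩ := key hm
  exact hx

/-- Each step of the filtration is spanned by sorted words. -/
theorem filtration_le_map_sorted (hΘ : IsCanonical Θ) (n : ℕ) :
    filtration lam kap n ≤ (sortedSpan k G ι (· ≤ n)).map (toH lam kap b) := by
  induction n using Nat.strong_induction_on with
  | _ n ih =>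
  refine (filtration_le_map_toH lam kap b n).trans (Submodule.map_le_iff_le_comap.2
    (wordFil_induction fun w g hw => ?_))
  rw [Submodule.mem_comap]
  set w' := w.insertionSort (· ≤ ·) with hw'
  have hlen : w'.length = w.length := List.length_insertionSort _ w
  have hmem' : toH lam kap b (word k w' g) ∈ filtration lam kap w.length :=
    hlen ▸ toH_word_mem lam kap b w' g
  -- A word and its sorted form agree in S(V) ⋊ G, hence have the same class, so they differ by
  -- something of lower degree.
  have hsub : toH lam kap b (word k w g) - toH lam kap b (word k w' g) ∈
      below (filtration lam kap) w.length := by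
    refine (grOf_eq_zero (filtration lam kap) (⟨_, toH_word_mem lam kap b w g⟩ - ⟨_, hmem'⟩)).1 ?_
    rw [map_sub, sub_eq_zero, ← canonical_toSkew_word b hΘ,
      toSkew_word_of_perm b (List.perm_insertionSort (· ≤ ·) w).symm, canonical_toSkew_word b hΘ]
    exact grOf_congr _ hlen _ _ rfl
  have hbelow : below (filtration lam kap) w.length ≤
      (sortedSpan k G ι (· ≤ n)).map (toH lam kap b) :=
    iSup₂_le fun i hi => (ih i (by omega)).trans
      (Submodule.map_mono (sortedSpan_mono fun l hl => by omega))
  rw [← sub_add_cancel (toH lam kap b (word k w g)) (toH lam kap b (word k w' g))]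
  exact Submodule.add_mem _ (hbelow hsub) (Submodule.mem_map_of_mem
    (word_mem_sortedSpan (List.pairwise_insertionSort _ w) (by rwa [← hw', hlen]) g))

/-- Words of length at most n span the n-th step. The shorter ones have class zero, and those of
length n have the class of their image under Θ. No condition on λ or κ is needed for this
surjectivity. -/
theorem map_skewDeg (b : Module.Basis ι k V) (hΘ : IsCanonical Θ) (n : ℕ) : (skewDeg k G V n).map Θ.toLinearMap =
    LinearMap.range (DirectSum.lof k ℕ (GrPiece (filtration lam kap)) n) := by
  rw [← map_toSkew b, ← range_grOf]
  apply le_antisymm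
  · rintro _ ⟨_, ⟨m, hm, rfl⟩, rfl⟩
    have hle : sortedSpan k G ι (· = n) ≤ wordFil k G ι n :=
      sortedSpan_le fun w g _ hw => word_mem_wordFil hw.le g
    exact ⟨_, (canonical_toSkew b hΘ hm (wordFil_le_comap_toH lam kap b n (hle hm))).symm⟩
  · rintro _ ⟨⟨x, hx⟩, rfl⟩
    obtain ⟨m, hm, rfl⟩ := filtration_le_map_toH lam kap b n hx
    let T : wordFil k G ι n →ₗ[k] filtration lam kap n :=
      (toH lam kap b).restrict (wordFil_le_comap_toH lam kap b n)
    have key : wordFil k G ι n ≤ ((((sortedSpan k G ι (· = n)).map (toSkew b)).map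
        Θ.toLinearMap).comap (grOf (filtration lam kap) n ∘ₗ T)).map (wordFil k G ι n).subtype := by
      refine wordFil_induction fun w g hw => ⟨⟨word k w g, word_mem_wordFil hw g⟩, ?_, rfl⟩
      change grOf (filtration lam kap) n ⟨toH lam kap b (word k w g), _⟩ ∈
        ((sortedSpan k G ι (· = n)).map (toSkew b)).map Θ.toLinearMap
      rcases hw.lt_or_eq with h | h
      · rw [(grOf_eq_zero (filtration lam kap) _).2
          (le_below (filtration lam kap) h (toH_word_mem lam kap b w g))]
        exact Submodule.zero_mem _
      · refine ⟨toSkew b (word k w g), ?_,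
          (canonical_toSkew_word b hΘ w g).trans (grOf_congr _ h _ _ rfl)⟩
        rw [toSkew_word_of_perm b (List.perm_insertionSort (· ≤ ·) w).symm]
        exact Submodule.mem_map_of_mem (word_mem_sortedSpan (List.pairwise_insertionSort _ w)
          (by rw [List.length_insertionSort, h]) g)
    obtain ⟨y, hy, hym⟩ := key hm
    subst hym
    exact hy

/-- If the sorted words are linearly independent in `H_{λ,κ}`, then the canonical map is injective
in each degree. -/
theorem canonical_injective_deg (hΘ : IsCanonical Θ)
    (h : ∀ m ∈ sortedSpan k G ι fun _ => True, toH lam kap b m = 0 → m = 0)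
    {n : ℕ} {f : SkewGroupAlgebra k G V} (hf : f ∈ skewDeg k G V n) (h0 : Θ f = 0) : f = 0 := by
  rw [← map_toSkew b] at hf
  obtain ⟨m, hm, rfl⟩ := hf
  have hle : sortedSpan k G ι (· = n) ≤ wordFil k G ι n :=
    sortedSpan_le fun w g _ hw => word_mem_wordFil hw.le g
  rw [canonical_toSkew b hΘ hm (wordFil_le_comap_toH lam kap b n (hle hm)), grOf_eq_zero] at h0
  have hbelow : below (filtration lam kap) n ≤ (sortedSpan k G ι (· < n)).map (toH lam kap b) :=
    iSup₂_le fun i hi => (filtration_le_map_sorted b hΘ i).trans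
      (Submodule.map_mono (sortedSpan_mono fun l hl => by omega))
  -- A vanishing class gives a combination `m'` of strictly shorter sorted words with the same image
  -- in H. Independence forces `m = m'`, and words of different lengths share only zero.
  obtain ⟨m', hm', e⟩ := hbelow h0
  have : m - m' = 0 := h _ (Submodule.sub_mem _ (sortedSpan_mono (fun _ _ => trivial) hm)
    (sortedSpan_mono (fun _ _ => trivial) hm')) ((map_sub _ _ _).trans (sub_eq_zero.2 e.symm))
  rw [sub_eq_zero] at this
  subst this
  rw [eq_zero_of_mem_sortedSpan (fun l h h' => by omega) hm hm', map_zero]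

end Comparison

end DrinfeldOrbifold

namespace DrinfeldOrbifold

open FilteredAlg

/-! ### The PBW property as injectivity of the canonical map -/

section PBW

variable {k G V ι : Type*} [Field k] [Group G] [Fintype G] [AddCommGroup V] [Module k V]
  [DistribMulAction G V] [SMulCommClass G k V] [LinearOrder ι]
  {lam : MonoidAlgebra k G →ₗ[k] V →ₗ[k] MonoidAlgebra k G}
  {kap : V →ₗ[k] V →ₗ[k] MonoidAlgebra k G × (V ⊗[k] MonoidAlgebra k G)}
  {Θ : SkewGroupAlgebra k G V →ₐ[k] Gr (filtration lam kap)}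

/-- Only spanning is needed: `isPBW_of_injective` takes the independence of degrees from the direct
sum in the target. -/
theorem iSup_skewDeg : ⨆ n, skewDeg k G V n = ⊤ := by
  have hP : ∀ s : SymmetricAlgebra k V,
      s ∈ ⨆ n, LinearMap.range (SymmetricAlgebra.ι k V) ^ n := by
    intro s
    induction s using SymmetricAlgebra.induction with
    | algebraMap r =>
      refine Submodule.mem_iSup_of_mem 0 ?_
      rw [pow_zero]
      exact Submodule.algebraMap_mem r
    | ι v => exact Submodule.mem_iSup_of_mem 1 (by rw [pow_one]; exact ⟨v, rfl⟩)
    | mul x y hx hy =>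
      have : (⨆ n, LinearMap.range (SymmetricAlgebra.ι k V) ^ n) *
          (⨆ n, LinearMap.range (SymmetricAlgebra.ι k V) ^ n) ≤
          ⨆ n, LinearMap.range (SymmetricAlgebra.ι k V) ^ n := by
        simp only [Submodule.iSup_mul, Submodule.mul_iSup, ← pow_add]
        exact iSup_le fun i => iSup_le fun j =>
          le_iSup (fun n => LinearMap.range (SymmetricAlgebra.ι k V) ^ n) _
      exact this (Submodule.mul_mem_mul hx hy)
    | add x y hx hy => exact Submodule.add_mem _ hx hy
  rw [eq_top_iff]
  intro f _
  rw [← SkewMonoidAlgebra.sum_single f, SkewMonoidAlgebra.sum_def, Finsupp.sum]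
  refine sum_mem fun g _ => ?_
  let T : SymmetricAlgebra k V →ₗ[k] SkewGroupAlgebra k G V :=
    { toFun := SkewMonoidAlgebra.single g
      map_add' := SkewMonoidAlgebra.single_add g
      map_smul' := fun c x => (SkewMonoidAlgebra.smul_single c g x).symm }
  have : (⨆ n, LinearMap.range (SymmetricAlgebra.ι k V) ^ n) ≤
      (⨆ n, skewDeg k G V n).comap T := by
    refine iSup_le fun n s hs => Submodule.mem_iSup_of_mem n fun a => ?_
    classical
    change (SkewMonoidAlgebra.single g s).coeff a ∈ _
    rw [SkewMonoidAlgebra.coeff_single_apply]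
    split_ifs
    · exact hs
    · exact Submodule.zero_mem _
  exact this (hP _)

/-- If the canonical map is injective in each degree, then `H_{λ,κ}` is a PBW deformation. -/
theorem isPBW_of_injective (b : Module.Basis ι k V) (hΘ : IsCanonical Θ)
    (hinj : ∀ n, ∀ f ∈ skewDeg k G V n, Θ f = 0 → f = 0) : IsPBWDeformation lam kap := by
  have hmap := fun n => map_skewDeg b hΘ n
  have hsurj : Function.Surjective Θ := by
    intro x
    induction x using DirectSum.induction_on with
    | zero => exact ⟨0, map_zero _⟩
    | of n x =>
      have : DirectSum.lof k ℕ (GrPiece (filtration lam kap)) n x ∈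
          (skewDeg k G V n).map Θ.toLinearMap := by
        rw [hmap]; exact ⟨x, rfl⟩
      obtain ⟨f, _, hf⟩ := this
      exact ⟨f, hf⟩
    | add x y hx hy =>
      obtain ⟨f, rfl⟩ := hx
      obtain ⟨f', rfl⟩ := hy
      exact ⟨f + f', map_add _ _ _⟩
  have hinj' : Function.Injective Θ := by
    rw [injective_iff_map_eq_zero]
    intro f hf
    obtain ⟨φ, hφ, rfl⟩ := (Submodule.mem_iSup_iff_exists_finsupp _ f).1
      (iSup_skewDeg (k := k) (G := G) (V := V) ▸ Submodule.mem_top)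
    refine Finset.sum_eq_zero fun n hn => hinj n _ (hφ n) ?_
    have hr : ∀ i, ∃ x, DirectSum.lof k ℕ (GrPiece (filtration lam kap)) i x = Θ (φ i) := by
      intro i
      have : Θ (φ i) ∈ (skewDeg k G V i).map Θ.toLinearMap := ⟨_, hφ i, rfl⟩
      rw [hmap] at this
      exact this
    choose x hx using hr
    -- Since Θ respects degrees, the n-th component of the image isolates the n-th summand.
    have hc : DirectSum.component k ℕ (GrPiece (filtration lam kap)) n (Θ (φ.sum fun _ y => y)) =
        x n := by
      rw [Finsupp.sum, map_sum, map_sum, Finset.sum_eq_single n]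
      · rw [← hx, DirectSum.component.lof_self]
      · intro i _ hi
        rw [← hx]
        exact DirectSum.of_eq_of_ne (β := GrPiece (filtration lam kap)) i n _ hi.symm
      · intro h
        exact absurd hn h
    rw [hf, map_zero] at hc
    rw [← hx, ← hc, map_zero]
  refine ⟨(AlgEquiv.ofBijective Θ ⟨hinj', hsurj⟩).symm, fun n => ?_⟩
  rw [← hmap n]
  ext f
  constructor
  · rintro ⟨_, ⟨f', hf', rfl⟩, rfl⟩
    have : (AlgEquiv.ofBijective Θ ⟨hinj', hsurj⟩).symm (Θ f') = f' :=
      (AlgEquiv.ofBijective Θ ⟨hinj', hsurj⟩).symm_apply_apply f'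
    change (AlgEquiv.ofBijective Θ ⟨hinj', hsurj⟩).symm (Θ f') ∈ _
    rwa [this]
  · intro hf
    exact ⟨Θ f, ⟨f, hf, rfl⟩, (AlgEquiv.ofBijective Θ ⟨hinj', hsurj⟩).symm_apply_apply f⟩

theorem finiteDimensional_skewDeg [FiniteDimensional k V] (n : ℕ) :
    Module.Finite k (skewDeg k G V n) := by
  let b := Module.finBasis k V
  rw [← map_toSkew b n, sortedSpan, Finsupp.supported_eq_span_single, Submodule.map_span]
  exact FiniteDimensional.span_of_finite k (((Set.Finite.subset
    (s := {w : List (Fin (Module.finrank k V)) | w.length = n} ×ˢ Set.univ)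
    ((List.finite_length_eq _ n).prod Set.finite_univ)
    (fun p hp => ⟨hp.2, trivial⟩)).image _).image _)

/-- If `H_{λ,κ}` is a PBW deformation, then the canonical map is injective in each degree. -/
theorem injective_of_isPBW [FiniteDimensional k V] (hΘ : IsCanonical Θ)
    (h : IsPBWDeformation lam kap) {n : ℕ} {f : SkewGroupAlgebra k G V}
    (hf : f ∈ skewDeg k G V n) (h0 : Θ f = 0) : f = 0 := by
  obtain ⟨e, he⟩ := h
  have := finiteDimensional_skewDeg (k := k) (G := G) (V := V) n
  have hmap := map_skewDeg (Module.finBasis k V) hΘ n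
  have hle : skewDeg k G V n ≤ (skewDeg k G V n).comap (e.toLinearMap ∘ₗ Θ.toLinearMap) := by
    intro x hx
    have hx' : Θ x ∈ (skewDeg k G V n).map Θ.toLinearMap := ⟨x, hx, rfl⟩
    rw [hmap] at hx'
    have : e (Θ x) ∈ (LinearMap.range (DirectSum.lof k ℕ (GrPiece (filtration lam kap)) n)).map
      e.toLinearMap := ⟨_, hx', rfl⟩
    rw [he] at this
    exact this
  let φ : skewDeg k G V n →ₗ[k] skewDeg k G V n :=
    (e.toLinearMap ∘ₗ Θ.toLinearMap).restrict fun x hx => hle hx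
  have hsurj : Function.Surjective φ := by
    rintro ⟨y, hy⟩
    rw [← he n] at hy
    obtain ⟨z, hz, rfl⟩ := hy
    rw [← hmap] at hz
    obtain ⟨x, hx, rfl⟩ := hz
    exact ⟨⟨x, hx⟩, rfl⟩
  -- The given isomorphism need not be related to Θ; finite dimension of the degree n part is what
  -- turns surjectivity of the composite into injectivity.
  have hinj : Function.Injective φ := OrzechProperty.injective_of_surjective_endomorphism φ hsurj
  have := hinj (a₁ := ⟨f, hf⟩) (a₂ := 0) (Subtype.ext (by
    change e (Θ f) = e (Θ 0)
    rw [h0, map_zero, map_zero, map_zero]))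
  exact congrArg Subtype.val this

end PBW

end DrinfeldOrbifold

namespace DrinfeldOrbifold

open FilteredAlg

/-! ### Reading off the conditions from a PBW deformation -/

section Necessity

variable {k G V : Type*} [Field k] [Group G] [Fintype G] [AddCommGroup V] [Module k V]
  [FiniteDimensional k V] [DistribMulAction G V] [SMulCommClass G k V]
  {lam : MonoidAlgebra k G →ₗ[k] V →ₗ[k] MonoidAlgebra k G}
  {kap : V →ₗ[k] V →ₗ[k] MonoidAlgebra k G × (V ⊗[k] MonoidAlgebra k G)}
  {Θ : SkewGroupAlgebra k G V →ₐ[k] Gr (filtration lam kap)}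

theorem ι_eq_zero {v : V} (h : SymmetricAlgebra.ι k V v = 0) : v = 0 := by
  let b := Module.finBasis k V
  refine b.ext_elem fun i => MvPolynomial.C_injective (Fin (Module.finrank k V)) k ?_
  rw [← pderiv_equivMvPolynomial_ι b i v, h]
  simp

theorem canonical_single (hΘ : IsCanonical Θ) (a : G) (s : SymmetricAlgebra k V) :
    Θ (SkewMonoidAlgebra.single a s) = Θ (SkewMonoidAlgebra.single 1 s) * grG lam kap a := by
  rw [← hΘ.2, ← map_mul, SkewMonoidAlgebra.single_mul_single]
  simp

theorem coeff_sum_single (s : G → SymmetricAlgebra k V) (g : G) :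
    (∑ a : G, SkewMonoidAlgebra.single a (s a)).coeff g = s g := by
  classical
  have := map_sum (SkewMonoidAlgebra.coeffAddEquiv (G := G) (k := SymmetricAlgebra k V))
    (fun a => SkewMonoidAlgebra.single a (s a)) Finset.univ
  have h := DFunLike.congr_fun this g
  rw [Finsupp.finsetSum_apply] at h
  refine h.trans ?_
  rw [Finset.sum_eq_single g]
  · exact (SkewMonoidAlgebra.coeff_single_apply).trans (if_pos rfl)
  · exact fun a _ ha => (SkewMonoidAlgebra.coeff_single_apply).trans (if_neg ha)
  · simp

/-- Degreewise injectivity of the canonical map, tested on `∑ₐ sₐ a`. -/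
theorem coeff_eq_zero_of_canonical
    (hinj : ∀ n, ∀ f ∈ skewDeg k G V n, Θ f = 0 → f = 0) (hΘ : IsCanonical Θ)
    (n : ℕ) (s : G → SymmetricAlgebra k V)
    (hs : ∀ a, s a ∈ LinearMap.range (SymmetricAlgebra.ι k V) ^ n)
    (h : ∑ a : G, Θ (SkewMonoidAlgebra.single 1 (s a)) * grG lam kap a = 0) (a : G) : s a = 0 := by
  have hf := hinj n (∑ a : G, SkewMonoidAlgebra.single a (s a))
    (fun g => by rw [coeff_sum_single]; exact hs g)
    (by rw [map_sum, ← h]; exact Finset.sum_congr rfl fun a _ => canonical_single hΘ a _)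
  rw [← coeff_sum_single s a, hf, SkewMonoidAlgebra.coeff_zero]
  rfl

theorem eq_zero_of_fromG_eq_zero
    (hinj : ∀ n, ∀ f ∈ skewDeg k G V n, Θ f = 0 → f = 0) (hΘ : IsCanonical Θ)
    {x : MonoidAlgebra k G} (h : fromG lam kap x = 0) : x = 0 := by
  have key := coeff_eq_zero_of_canonical hinj hΘ 0
    (fun a => algebraMap k (SymmetricAlgebra k V) (x.coeff a))
    (fun a => by rw [pow_zero]; exact Submodule.algebraMap_mem _) (by
      have h1 : ∀ a, Θ (SkewMonoidAlgebra.single 1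
          (algebraMap k (SymmetricAlgebra k V) (x.coeff a))) * grG lam kap a =
          x.coeff a • grG lam kap a := by
        intro a
        have : (SkewMonoidAlgebra.single 1 (algebraMap k (SymmetricAlgebra k V) (x.coeff a)) :
            SkewGroupAlgebra k G V) = x.coeff a • 1 := by
          rw [SkewMonoidAlgebra.one_def, SkewMonoidAlgebra.smul_single,
            Algebra.algebraMap_eq_smul_one]
        rw [this, map_smul, map_one, smul_mul_assoc, one_mul]
      rw [Finset.sum_congr rfl fun a _ => h1 a]
      simp only [grG_apply]
      rw [Finset.sum_congr rfl fun a _ => (map_smul _ _ _).symm, ← map_sum]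
      rw [grOf_eq_zero]
      have : ((∑ a : G, x.coeff a • (⟨fromG lam kap (elt k a), fromG_mem lam kap _⟩ :
          filtration lam kap 0) : filtration lam kap 0) : Hlk lam kap) = fromG lam kap x := by
        rw [map_eq_sum (fromG lam kap) x]
        simp
      rw [this, h]
      exact Submodule.zero_mem _)
  ext a
  have := key a
  have hC := congrArg (SymmetricAlgebra.equivMvPolynomial (Module.finBasis k V)) this
  rw [AlgEquiv.commutes, map_zero, MvPolynomial.algebraMap_eq] at hC
  simpa using hC

theorem eq_zero_of_sum_fromV_mem
    (hinj : ∀ n, ∀ f ∈ skewDeg k G V n, Θ f = 0 → f = 0) (hΘ : IsCanonical Θ)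
    {y : G → V}
    (h : ∑ a : G, fromV lam kap (y a) * fromG lam kap (elt k a) ∈ filtration lam kap 0) (a : G) :
    y a = 0 := by
  refine ι_eq_zero (coeff_eq_zero_of_canonical hinj hΘ 1
    (fun a => SymmetricAlgebra.ι k V (y a)) (fun a => by rw [pow_one]; exact ⟨_, rfl⟩) ?_ a)
  have h1 : ∀ a, Θ (SkewMonoidAlgebra.single 1 (SymmetricAlgebra.ι k V (y a))) * grG lam kap a =
      grOf (filtration lam kap) 1 ⟨_, fromV_mul_fromG_mem lam kap (y a) (elt k a)⟩ := fun a => by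
    rw [hΘ.1, grV_apply, grG_apply, grOf_mul]
  simp only [h1, ← map_sum]
  rw [grOf_eq_zero]
  refine le_below _ zero_lt_one ?_
  simpa using h

/-- The kG term has degree 0, so the class of the vector term in degree 1 vanishes; once the vectors
are zero, degree 0 gives the rest. -/
theorem eq_zero_of_sum_fromV_add_fromG
    (hinj : ∀ n, ∀ f ∈ skewDeg k G V n, Θ f = 0 → f = 0) (hΘ : IsCanonical Θ)
    {y : G → V} {x : MonoidAlgebra k G}
    (h : ∑ a : G, fromV lam kap (y a) * fromG lam kap (elt k a) + fromG lam kap x = 0) :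
    (∀ a, y a = 0) ∧ x = 0 := by
  have hy := eq_zero_of_sum_fromV_mem hinj hΘ (y := y) (by
    rw [eq_neg_of_add_eq_zero_left h]
    exact Submodule.neg_mem _ (fromG_mem lam kap x))
  refine ⟨hy, eq_zero_of_fromG_eq_zero hinj hΘ ?_⟩
  simpa [hy] using h

theorem sum_ι_mul_ι_eq_zero
    (hinj : ∀ n, ∀ f ∈ skewDeg k G V n, Θ f = 0 → f = 0) (hΘ : IsCanonical Θ)
    {κ : Type*} [Fintype κ] {p q : G → κ → V}
    (h : ∑ a : G, (∑ t, fromV lam kap (p a t) * fromV lam kap (q a t)) * fromG lam kap (elt k a) ∈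
      filtration lam kap 1) (a : G) :
    ∑ t, SymmetricAlgebra.ι k V (p a t) * SymmetricAlgebra.ι k V (q a t) = 0 := by
  refine coeff_eq_zero_of_canonical hinj hΘ 2
    (fun a => ∑ t, SymmetricAlgebra.ι k V (p a t) * SymmetricAlgebra.ι k V (q a t))
    (fun a => Submodule.sum_mem _ fun t _ => by
      rw [pow_two]; exact Submodule.mul_mem_mul ⟨_, rfl⟩ ⟨_, rfl⟩) ?_ a
  have hm : ∀ a, (∑ t, fromV lam kap (p a t) * fromV lam kap (q a t)) *
      fromG lam kap (elt k a) ∈ filtration lam kap 2 := fun a =>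
    SetLike.mul_mem_graded (A := filtration lam kap) (i := 2) (j := 0)
      (Submodule.sum_mem _ fun t _ => SetLike.mul_mem_graded (A := filtration lam kap)
        (i := 1) (j := 1) (fromV_mem lam kap _) (fromV_mem lam kap _)) (fromG_mem lam kap _)
  have h1 : ∀ a, Θ (SkewMonoidAlgebra.single 1 (∑ t, SymmetricAlgebra.ι k V (p a t) *
      SymmetricAlgebra.ι k V (q a t))) * grG lam kap a =
      grOf (filtration lam kap) 2 ⟨_, hm a⟩ := fun a => by
    have hs : (SkewMonoidAlgebra.single 1 (∑ t, SymmetricAlgebra.ι k V (p a t) *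
        SymmetricAlgebra.ι k V (q a t)) : SkewGroupAlgebra k G V) =
        ∑ t, SkewMonoidAlgebra.single 1 (SymmetricAlgebra.ι k V (p a t)) *
          SkewMonoidAlgebra.single 1 (SymmetricAlgebra.ι k V (q a t)) := by
      simp only [SkewMonoidAlgebra.single_mul_single, one_smul, mul_one]
      exact map_sum (SkewMonoidAlgebra.singleAddHom (1 : G)) _ _
    rw [hs, map_sum, Finset.sum_mul]
    simp only [map_mul, hΘ.1, grV_apply, grG_apply, grOf_mul]
    rw [← map_sum]
    refine congrArg _ (Subtype.ext ?_)
    simp [Finset.sum_mul]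
  simp only [h1, ← map_sum]
  rw [grOf_eq_zero]
  refine le_below _ one_lt_two ?_
  simpa using h

/-- Associativity of `(g h) v` forces `λ` to be a twisted derivation in its first argument. -/
theorem lam_mul_of_canonical
    (hinj : ∀ n, ∀ f ∈ skewDeg k G V n, Θ f = 0 → f = 0) (hΘ : IsCanonical Θ)
    (g h : G) (v : V) :
    lam (elt k (g * h)) v = lam (elt k g) (h • v) * elt k h + elt k g * lam (elt k h) v := by
  rw [← sub_eq_zero]
  refine eq_zero_of_fromG_eq_zero hinj hΘ ?_
  have h1 := fromG_mul_fromV lam kap (g * h) v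
  rw [elt_mul, map_mul, mul_assoc, fromG_mul_fromV, mul_add, ← mul_assoc, fromG_mul_fromV,
    add_mul, mul_smul, mul_assoc, add_assoc, add_right_inj] at h1
  rw [map_sub, map_add, map_mul, map_mul, elt_mul, sub_eq_zero, ← h1]

/-- In H the left side of `elt_mul_relOp` is zero, and the coefficients on its right side are
independent. -/
theorem defect_eq_zero
    (hinj : ∀ n, ∀ f ∈ skewDeg k G V n, Θ f = 0 → f = 0) (hΘ : IsCanonical Θ)
    (g : G) (u v : V) :
    (∀ h, vecDefect lam kap g h u v = 0) ∧ groupDefect lam kap g u v = 0 := by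
  refine eq_zero_of_sum_fromV_add_fromG hinj hΘ ?_
  rw [← elt_mul_relOp kap (fromG_mul_fromV lam kap) g u v]
  simp [relOp_fromV]

theorem altSum_jacobi (x y z : V) :
    - ∑ a : G, altSum (jacobiPolar kap (fromV lam kap) a) x y z * fromG lam kap (elt k a) -
      ∑ g : G, fromV lam kap (altSum (jacobiVec lam kap g) x y z) * fromG lam kap (elt k g) +
      fromG lam kap (altSum (jacobiGroup lam kap) x y z) = 0 := by
  rw [← altSum_commutator_kapOp kap (fromG_mul_fromV lam kap) x y z]
  have hk : ∀ u v, kapOp kap (fromV lam kap) (fromG lam kap) u v =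
      fromV lam kap u * fromV lam kap v - fromV lam kap v * fromV lam kap u := fun u v => by
    have := relOp_fromV lam kap u v
    rw [relOp_apply, sub_eq_zero] at this
    exact this.symm
  simp only [altSum, relOp_fromV, zero_mul, Finset.sum_const_zero, add_zero, hk, ← smul_add]
  -- In H every κ(u, v) is the commutator [u, v], so what remains is the Jacobi identity of an
  -- associative algebra.
  rw [smul_eq_zero_of_right]
  simp only [sub_mul, mul_sub, mul_assoc]
  abel

/-- In `altSum_jacobi` every term except the quadratic one has degree at most 1, so the class of the
quadratic term in degree 2 vanishes. -/
theorem altSum_ι_eq_zero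
    (hinj : ∀ n, ∀ f ∈ skewDeg k G V n, Θ f = 0 → f = 0) (hΘ : IsCanonical Θ)
    (h2 : (2 : k) ≠ 0) (g : G) (x y z : V) :
    altSum (fun x y z => SymmetricAlgebra.ι k V (kapLAt kap g x y) *
      SymmetricAlgebra.ι k V (z - g • z)) x y z = 0 := by
  have key := sum_ι_mul_ι_eq_zero hinj hΘ
    (p := fun a => ![kapLAt kap a x y, kapLAt kap a y z, kapLAt kap a z x])
    (q := fun a => ![z - a • z, x - a • x, y - a • y]) (by
      rw [← Submodule.smul_mem_iff _ h2]
      -- Reordering the symmetric product costs a value of κ, of degree at most 1; up to such terms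
      -- it is twice the ordered product, and 2 can be cancelled.
      have hp : ∀ a x y z, jacobiPolar kap (fromV lam kap) a x y z =
          (2 : k) • (fromV lam kap (kapLAt kap a x y) * fromV lam kap (z - a • z)) +
          kapOp kap (fromV lam kap) (fromG lam kap) (z - a • z) (kapLAt kap a x y) := by
        intro a x y z
        have := relOp_fromV lam kap (z - a • z) (kapLAt kap a x y)
        rw [relOp_apply, sub_eq_zero] at this
        rw [← this, jacobiPolar, two_smul]
        abel
      have hJ := altSum_jacobi (lam := lam) (kap := kap) x y z
      have hsum : (2 : k) • ∑ a : G, (∑ t, fromV lam kap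
            (![kapLAt kap a x y, kapLAt kap a y z, kapLAt kap a z x] t) *
            fromV lam kap (![z - a • z, x - a • x, y - a • y] t)) * fromG lam kap (elt k a) =
          ∑ a : G, altSum (jacobiPolar kap (fromV lam kap) a) x y z * fromG lam kap (elt k a) -
          ∑ a : G, altSum (fun x y z => kapOp kap (fromV lam kap) (fromG lam kap) (z - a • z)
            (kapLAt kap a x y)) x y z * fromG lam kap (elt k a) := by
        rw [← Finset.sum_sub_distrib, Finset.smul_sum]
        refine Finset.sum_congr rfl fun a _ => ?_
        rw [← sub_mul, ← smul_mul_assoc]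
        congr 1
        simp only [altSum, hp, Fin.sum_univ_three, Matrix.cons_val, smul_add]
        abel
      rw [hsum]
      refine Submodule.sub_mem _ ?_ (Submodule.sum_mem _ fun a _ => ?_)
      · rw [add_eq_zero_iff_eq_neg, sub_eq_iff_eq_add, neg_eq_iff_eq_neg] at hJ
        rw [hJ]
        exact Submodule.neg_mem _ (Submodule.add_mem _ (Submodule.neg_mem _
          (filtration_mono lam kap zero_le_one (fromG_mem lam kap _)))
          (Submodule.sum_mem _ fun a _ => fromV_mul_fromG_mem lam kap _ _))
      · exact SetLike.mul_mem_graded (A := filtration lam kap) (i := 1) (j := 0)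
          (Submodule.add_mem _ (Submodule.add_mem _ (kapOp_fromV_mem lam kap _ _)
            (kapOp_fromV_mem lam kap _ _)) (kapOp_fromV_mem lam kap _ _)) (fromG_mem lam kap _)) g
  simpa [Fin.sum_univ_three, altSum] using key

/-- The identity in S(V) kills the quadratic term exactly and not merely up to lower degree, so
degrees 1 and 0 can be compared next. -/
theorem altSum_jacobi_eq_zero
    (hinj : ∀ n, ∀ f ∈ skewDeg k G V n, Θ f = 0 → f = 0) (hΘ : IsCanonical Θ)
    (h2 : (2 : k) ≠ 0) (x y z : V) :
    (∀ g, altSum (jacobiVec lam kap g) x y z = 0) ∧ altSum (jacobiGroup lam kap) x y z = 0 := by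
  have hJ := altSum_jacobi (lam := lam) (kap := kap) x y z
  simp only [altSum_jacobiPolar_eq_zero (Module.finBasis k V) (fromV lam kap)
    (altSum_ι_eq_zero hinj hΘ h2 _ x y z), zero_mul, Finset.sum_const_zero, neg_zero,
    zero_sub] at hJ
  have := eq_zero_of_sum_fromV_add_fromG hinj hΘ (x := - altSum (jacobiGroup lam kap) x y z)
    (y := fun g => altSum (jacobiVec lam kap g) x y z) (by
      rw [map_neg, ← neg_eq_zero, neg_add, neg_neg]
      exact hJ)
  exact ⟨this.1, neg_eq_zero.1 this.2⟩

end Necessity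

/-! ### The Jacobi-type conditions in coordinates -/

section Conditions

variable {k G V : Type*} [Field k] [Group G] [Fintype G] [AddCommGroup V] [Module k V]
  [DistribMulAction G V] [SMulCommClass G k V]
  (lam : MonoidAlgebra k G →ₗ[k] V →ₗ[k] MonoidAlgebra k G)
  (kap : V →ₗ[k] V →ₗ[k] MonoidAlgebra k G × (V ⊗[k] MonoidAlgebra k G))

/-- The middle sum is rotated from (z; x, y) to (x; y, z), which a cyclic sum does not see. -/
theorem altSum_jacobiVec (g : G) (v₁ v₂ v₃ : V) :
    altSum (jacobiVec lam kap g) v₁ v₂ v₃ =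
      (2 : k) • altSum (fun x y z => kapCAt kap g x y • (z - g • z)) v₁ v₂ v₃ +
      ∑ a : G, altSum (fun x y z =>
        kapLAt kap (g * a⁻¹) (x + a • x) (kapLAt kap a y z)) v₁ v₂ v₃ -
      (2 : k) • ∑ a : G, altSum (fun x y z =>
        lamAt lam g a z • kapLAt kap a x y) v₁ v₂ v₃ := by
  simp only [altSum, jacobiVec, Finset.sum_add_distrib, smul_add]
  abel

theorem coeff_altSum_jacobiGroup (g : G) (v₁ v₂ v₃ : V) :
    (altSum (jacobiGroup lam kap) v₁ v₂ v₃).coeff g =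
      2 * altSum (fun x y z => (lam (kapC kap x y) z).coeff g) v₁ v₂ v₃ -
      ∑ a : G, altSum (fun x y z =>
        kapCAt kap (g * a⁻¹) (x + a • x) (kapLAt kap a y z)) v₁ v₂ v₃ := by
  -- Right multiplication by a shifts coefficients, which is the origin of the index g a⁻¹.
  have h : ∀ (a : G) (x : MonoidAlgebra k G), (x * elt k a).coeff g = x.coeff (g * a⁻¹) :=
    fun a x => by
      change (x * MonoidAlgebra.single a 1).coeff g = _
      rw [MonoidAlgebra.coeff_mul_single_eq_coeff_mul (g * a⁻¹) fun m _ => eq_mul_inv_iff_mul_eq.symm,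
        mul_one]
  simp only [altSum, jacobiGroup, MonoidAlgebra.coeff_add, MonoidAlgebra.coeff_sub,
    MonoidAlgebra.coeff_smul, MonoidAlgebra.coeff_sum, Finsupp.add_apply, Finsupp.sub_apply,
    Finsupp.smul_apply, Finsupp.finsetSum_apply, h, kapCAt, Finset.sum_add_distrib, smul_eq_mul]
  ring

end Conditions

end DrinfeldOrbifold

theorem theorem6p1 {k G V : Type*} [Field k] (h2 : (2 : k) ≠ 0)
    [Group G] [Fintype G] [AddCommGroup V] [Module k V] [FiniteDimensional k V]
    [DistribMulAction G V] [SMulCommClass G k V]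
    (lam : MonoidAlgebra k G →ₗ[k] V →ₗ[k] MonoidAlgebra k G)
    (kap : V →ₗ[k] V →ₗ[k] MonoidAlgebra k G × (V ⊗[k] MonoidAlgebra k G))
    (hkap : ∀ v, kap v v = 0) :
    IsPBWDeformation lam kap ↔
      -- (1), in `kG`
      (∀ (g h : G) (v : V),
        lam (elt k (g * h)) v = lam (elt k g) (h • v) * elt k h + elt k g * lam (elt k h) v) ∧
      -- (2), in `kG`
      (∀ (g : G) (u v : V),
        kapC kap (g • u) (g • v) * elt k g - elt k g * kapC kap u v =
          lam (lam (elt k g) v) u - lam (lam (elt k g) u) v +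
            ∑ a : G, lam (elt k g) (kapLAt kap a u v) * elt k a) ∧
      -- (3), in `V`
      (∀ (g h : G) (u v : V),
        g • kapLAt kap (g⁻¹ * h) u v - kapLAt kap (h * g⁻¹) (g • u) (g • v) =
          lamAt lam h g u • (h • v - g • v) - lamAt lam h g v • (h • u - g • u)) ∧
      -- (4), in `V`
      (∀ (g : G) (v₁ v₂ v₃ : V),
        (0 : V) =
          (2 : k) • altSum (fun x y z => kapCAt kap g x y • (z - g • z)) v₁ v₂ v₃ +
          ∑ a : G, altSum (fun x y z =>
            kapLAt kap (g * a⁻¹) (x + a • x) (kapLAt kap a y z)) v₁ v₂ v₃ -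
          (2 : k) • ∑ a : G, altSum (fun x y z =>
            lamAt lam g a z • kapLAt kap a x y) v₁ v₂ v₃) ∧
      -- (5), in `k`, as the coefficient of `g`
      (∀ (g : G) (v₁ v₂ v₃ : V),
        2 * altSum (fun x y z => (lam (kapC kap x y) z).coeff g) v₁ v₂ v₃ =
          ∑ a : G, altSum (fun x y z =>
            kapCAt kap (g * a⁻¹) (x + a • x) (kapLAt kap a y z)) v₁ v₂ v₃) ∧
      -- (6), in `S(V)`
      (∀ (g : G) (u v w : V),
        0 =
          SymmetricAlgebra.ι k V (kapLAt kap g u v) * SymmetricAlgebra.ι k V (w - g • w) +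
          SymmetricAlgebra.ι k V (kapLAt kap g v w) * SymmetricAlgebra.ι k V (u - g • u) +
          SymmetricAlgebra.ι k V (kapLAt kap g w u) * SymmetricAlgebra.ι k V (v - g • v)) := by 
  constructor
  · intro hP
    obtain ⟨Θ, hΘ⟩ := exists_canonical lam kap
    have hinj : ∀ n, ∀ f ∈ skewDeg k G V n, Θ f = 0 → f = 0 :=
      fun n f hf h0 => injective_of_isPBW hΘ hP hf h0
    refine ⟨lam_mul_of_canonical hinj hΘ, fun g u v => sub_eq_zero.1 (defect_eq_zero hinj hΘ g u v).2,
      fun g h u v => (sub_eq_zero.1 ((defect_eq_zero hinj hΘ g u v).1 h)).symm,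
      fun g x y z => ?_, fun g x y z => ?_, fun g u v w => (altSum_ι_eq_zero hinj hΘ h2 g u v w).symm⟩
    · rw [← altSum_jacobiVec, (altSum_jacobi_eq_zero hinj hΘ h2 x y z).1 g]
    · rw [← sub_eq_zero, ← coeff_altSum_jacobiGroup, (altSum_jacobi_eq_zero hinj hΘ h2 x y z).2]
      rfl
  · rintro ⟨h1, hg, hv, hjv, hjg, hs⟩
    obtain ⟨Θ, hΘ⟩ := exists_canonical lam kap
    let b := Module.finBasis k V
    refine isPBW_of_injective b hΘ fun n f hf h0 =>
      canonical_injective_deg b hΘ (fun m hm hm0 => ?_) hf h0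
    refine eq_zero_of_toH_eq_zero b h2 hkap h1 (fun g u v => sub_eq_zero.2 (hg g u v))
      (fun g h u v => sub_eq_zero.2 (hv g h u v).symm) (fun g x y z => ?_) (fun x y z => ?_)
      (fun g x y z => (hs g x y z).symm) hm hm0
    · rw [altSum_jacobiVec, ← hjv]
    · ext g
      rw [coeff_altSum_jacobiGroup, hjg, sub_self]
      rfl
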